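/- **Theorem (Gaussian mean estimation model).** Let $\alpha\in(1/2,1)$, $\eta>0$, $\sigma_e>0$ and let $C$ satisfy $\eta C>1$. Let $e_1,e_2,\dots$ be i.i.d. $\mathcal N(0,\sigma_e^2)$ random variables, put $\eta_i=\eta i^{-\alpha}$, and define $$X_0=0,\qquad X_i=(1-\eta_i)X_{i-1}+\eta_i e_i\quad(i\ge1).$$ Let $\ell_i=\lfloor C i^{\alpha}\log i\rfloor$ and $t_i=\max(1,\,i-\ell_i+1)$ for $i\ge 1$, and set $$\widehat\sigma_n=\frac1n\sum_{i=1}^n\Bigl[X_i^2+2X_i\sum_{j=t_i}^{i-1}X_j\Bigr],\qquad \bar X_n=\frac1n\sum_{i=1}^nX_i,\qquad \sigma_n=\operatorname{Var}(\sqrt n\,\bar X_n),$$ where sums over an empty range are $0$. Then $$\mathbb E\bigl[(\widehat\sigma_n-\sigma_n)^2\bigr]\asymp n^{\alpha-1}\log n,$$ that is, there are constants $0<c_1\le c_2<\infty$, depending only on $\alpha,\eta,C,\sigma_e$, such that for all $n\ge2$ $$c_1\,n^{\alpha-1}\log n\;\le\;\mathbb E\bigl[(\widehat\sigma_n-\sigma_n)^2\bigr]\;\le\;c_2\,n^{\alpha-1}\log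 n .$$ -/

import Mathlib

open MeasureTheory ProbabilityTheory
open scoped NNReal

namespace GaussianMeanEstimation

/-- The step size `η_i = η i^{-α}` (used for `i ≥ 1`). -/
noncomputable def stepSize (η α : ℝ) (i : ℕ) : ℝ := η * (i : ℝ) ^ (-α)

/-- The SGD iterates for the mean estimation model with true mean `0` and errors `e 1, e 2, …`:
`X_0 = 0` and `X_i = (1 - η_i) X_{i-1} + η_i e_i` for `i ≥ 1`. The value `e 0` is never used. -/
noncomputable def iterate {Ω : Type*} (η α : ℝ) (e : ℕ → Ω → ℝ) : ℕ → Ω → ℝ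
  | 0, _ => 0
  | i + 1, ω =>
      (1 - stepSize η α (i + 1)) * iterate η α e i ω + stepSize η α (i + 1) * e (i + 1) ω

/-- The batch size `ℓ_i = ⌊C i^α log i⌋`, which is nonnegative when `C ≥ 0` and `i ≥ 1`. -/
noncomputable def batchSize (α C : ℝ) (i : ℕ) : ℕ := ⌊C * (i : ℝ) ^ α * Real.log i⌋₊

/-- The batch start `t_i = i - ℓ_i + 1`, replaced by `1` for the finitely many small `i` with
`ℓ_i > i`, so that a batch only holds iterates `X_j` with `j ≥ 1`. -/
noncomputable def batchStart (α C : ℝ) (i : ℕ) : ℕ := max 1 (i + 1 - batchSize α C i)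

/-- `W_i = X_{t_i} + ⋯ + X_{i-1}`, an empty sum when `ℓ_i ≤ 1`. -/
noncomputable def batchSum {Ω : Type*} (η α C : ℝ) (e : ℕ → Ω → ℝ) (i : ℕ) (ω : Ω) : ℝ :=
  ∑ j ∈ Finset.Ico (batchStart α C i) i, iterate η α e j ω

/-- The estimator `σ̂_n = n⁻¹ ∑_{i=1}^n (X_i² + 2 X_i W_i)`. -/
noncomputable def sigmaHat {Ω : Type*} (η α C : ℝ) (e : ℕ → Ω → ℝ) (n : ℕ) (ω : Ω) : ℝ :=
  (n : ℝ)⁻¹ * ∑ i ∈ Finset.Icc 1 n,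
    (iterate η α e i ω ^ 2 + 2 * iterate η α e i ω * batchSum η α C e i ω)

/-- The averaged iterate `X̄_n = n⁻¹ ∑_{i=1}^n X_i`. -/
noncomputable def average {Ω : Type*} (η α : ℝ) (e : ℕ → Ω → ℝ) (n : ℕ) (ω : Ω) : ℝ :=
  (n : ℝ)⁻¹ * ∑ i ∈ Finset.Icc 1 n, iterate η α e i ω

/-- The finite-sample variance `σ_n = Var(√n X̄_n)`. -/
noncomputable def sigmaN {Ω : Type*} [MeasurableSpace Ω] (μ : Measure Ω) (η α : ℝ)
    (e : ℕ → Ω → ℝ) (n : ℕ) : ℝ :=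
  variance (fun ω => √(n : ℝ) * average η α e n ω) μ

/-- The mean squared error `E[(σ̂_n - σ_n)²]`. -/
noncomputable def mse {Ω : Type*} [MeasurableSpace Ω] (μ : Measure Ω) (η α C : ℝ)
    (e : ℕ → Ω → ℝ) (n : ℕ) : ℝ :=
  ∫ ω, (sigmaHat η α C e n ω - sigmaN μ η α e n) ^ 2 ∂μ

end GaussianMeanEstimation

namespace GaussianMeanEstimation

/-! Each iterate is linear in the errors, so `n σ̂_n` is a quadratic form in independent centred
Gaussians with matrix `quadCoef`. The mean squared error splits exactly into squared bias plus
variance (`mse_eq`), and for a Gaussian quadratic form the variance is `v² / 2` times the sum of the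
squared entries of the symmetrized matrix. What remains is deterministic estimation of the
coefficients `coef η α i j`.

An error enters with weight about `η j ^ (-α)` and decays over about `j ^ α / η` steps, so both the
rows and the columns of `coef` have bounded `ℓ¹` norm (`exists_row_bound`, `exists_column_bound`).

Bias: only covariances between `X_i` and iterates before its batch are lost. Across a batch the
weights shrink by `exp (-∑ η_k)`, which is `O(i ^ (-η C))`. As `η C > 1` this is summable, and the
bias of `n σ̂_n` stays bounded (`exists_bias_bound`).

Variance: the entries of `quadCoef` are bounded and their `ℓ¹` norm is `O(n · n ^ α log n)`, since
row `i` contributes in proportion to its batch length; hence the sum of squares has the same order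
(`exists_quadCoef_bound`). Conversely, about `n` indices `k` with about `n ^ α log n` indices `j`
each give entries bounded below (`eventually_le_sum_quadCoef_sq`). Division by `n²` yields `n ^ (α -
1) log n`, and the squared bias `O(n⁻²)` is negligible. -/

/-! ### Gaussian moments up to order four. -/

theorem iteratedDeriv_exp_mul_sq (v : ℝ) :
    iteratedDeriv 3 (fun t : ℝ => Real.exp (v * t ^ 2 / 2)) 0 = 0 ∧
      iteratedDeriv 4 (fun t : ℝ => Real.exp (v * t ^ 2 / 2)) 0 = 3 * v ^ 2 := by
  have h0 : ∀ t : ℝ, HasDerivAt (fun t : ℝ => Real.exp (v * t ^ 2 / 2))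
      (Real.exp (v * t ^ 2 / 2) * (v * t)) t := fun t => by
    have h : HasDerivAt (fun t : ℝ => v * t ^ 2 / 2) (v * t) t := by
      refine (((hasDerivAt_pow 2 t).const_mul v).div_const 2).congr_deriv ?_
      norm_num; ring
    exact h.exp
  -- Every derivative is the exponential times a polynomial; differentiation acts on the polynomial
  -- factor by `p ↦ v t p + p'`.
  have step : ∀ (p p' : ℝ → ℝ) (_ : ∀ t, HasDerivAt p (p' t) t),
      deriv (fun t => Real.exp (v * t ^ 2 / 2) * p t) =
        fun t => Real.exp (v * t ^ 2 / 2) * (v * t * p t + p' t) := fun p p' hp => by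
    funext t
    exact ((h0 t).mul (hp t)).deriv.trans (by ring)
  have e1 : iteratedDeriv 1 (fun t : ℝ => Real.exp (v * t ^ 2 / 2)) =
      fun t => Real.exp (v * t ^ 2 / 2) * (v * t) := by
    rw [iteratedDeriv_one]
    exact funext fun t => (h0 t).deriv
  have e2 : iteratedDeriv 2 (fun t : ℝ => Real.exp (v * t ^ 2 / 2)) =
      fun t => Real.exp (v * t ^ 2 / 2) * (v + v ^ 2 * t ^ 2) := by
    rw [iteratedDeriv_succ, e1, step _ (fun _ => v)]
    · funext t; ring
    · intro t; simpa using (hasDerivAt_id t).const_mul v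
  have e3 : iteratedDeriv 3 (fun t : ℝ => Real.exp (v * t ^ 2 / 2)) =
      fun t => Real.exp (v * t ^ 2 / 2) * (3 * v ^ 2 * t + v ^ 3 * t ^ 3) := by
    rw [iteratedDeriv_succ, e2, step _ (fun t => 2 * v ^ 2 * t)]
    · funext t; ring
    · intro t
      refine (((hasDerivAt_pow 2 t).const_mul (v ^ 2)).const_add v).congr_deriv ?_
      norm_num; ring
  have e4 : iteratedDeriv 4 (fun t : ℝ => Real.exp (v * t ^ 2 / 2)) =
      fun t => Real.exp (v * t ^ 2 / 2) * (3 * v ^ 2 + 6 * v ^ 3 * t ^ 2 + v ^ 4 * t ^ 4) := by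
    rw [iteratedDeriv_succ, e3, step _ (fun t => 3 * v ^ 2 + 3 * v ^ 3 * t ^ 2)]
    · funext t; ring
    · intro t
      refine (((hasDerivAt_id t).const_mul (3 * v ^ 2)).add
        ((hasDerivAt_pow 3 t).const_mul (v ^ 3))).congr_deriv ?_
      norm_num; ring
  constructor
  · rw [e3]; simp
  · rw [e4]; simp

theorem integral_pow_gaussianReal (v : ℝ≥0) :
    ∫ x, x ^ 2 ∂gaussianReal 0 v = v ∧ ∫ x, x ^ 3 ∂gaussianReal 0 v = 0 ∧
      ∫ x, x ^ 4 ∂gaussianReal 0 v = 3 * (v : ℝ) ^ 2 := by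
  have hz : (0 : ℝ) ∈ interior (integrableExpSet id (gaussianReal 0 v)) := by
    rw [integrableExpSet_id_gaussianReal]; simp
  have hm : mgf id (gaussianReal 0 v) = fun t : ℝ => Real.exp ((v : ℝ) * t ^ 2 / 2) := by
    rw [mgf_id_gaussianReal]; simp
  refine ⟨?_, ?_, ?_⟩
  · have h := variance_fun_id_gaussianReal (μ := 0) (v := v)
    rw [variance_of_integral_eq_zero (by fun_prop) (by simp)] at h
    exact h
  · have h := iteratedDeriv_mgf_zero hz 3
    rw [hm, (iteratedDeriv_exp_mul_sq v).1] at h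
    simpa using h.symm
  · have h := iteratedDeriv_mgf_zero hz 4
    rw [hm, (iteratedDeriv_exp_mul_sq v).2] at h
    simpa using h.symm

/-! ### Second moments of linear and quadratic forms in the errors. -/

section Noise

/-- Independent errors with the first four moments of `𝒩(0, v)`. -/
structure IsGaussianNoise {Ω : Type*} [MeasurableSpace Ω] (μ : Measure Ω) (v : ℝ)
    (ε : ℕ → Ω → ℝ) : Prop where
  indep : iIndepFun ε μ
  memLp : ∀ i, MemLp (ε i) 4 μ
  integral_eq : ∀ i, ∫ ω, ε i ω ∂μ = 0
  integral_sq : ∀ i, ∫ ω, ε i ω ^ 2 ∂μ = v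
  integral_cube : ∀ i, ∫ ω, ε i ω ^ 3 ∂μ = 0
  integral_four : ∀ i, ∫ ω, ε i ω ^ 4 ∂μ = 3 * v ^ 2

variable {Ω : Type*} [MeasurableSpace Ω] {μ : Measure Ω} {v : ℝ} {ε : ℕ → Ω → ℝ}

theorem IsGaussianNoise.of_hasLaw {v : ℝ≥0} (hi : iIndepFun ε μ)
    (hl : ∀ i, HasLaw (ε i) (gaussianReal 0 v) μ) : IsGaussianNoise μ v ε := by
  have key : ∀ i k, ∫ ω, ε i ω ^ k ∂μ = ∫ x, x ^ k ∂gaussianReal 0 v := fun i k =>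
    (hl i).integral_comp (f := fun x => x ^ k) (by fun_prop)
  refine ⟨hi, fun i => ?_, fun i => ?_, fun i => ?_, fun i => ?_, fun i => ?_⟩
  · have h : MemLp id 4 (gaussianReal 0 v) := memLp_id_gaussianReal 4
    rw [← (hl i).map_eq] at h
    exact (memLp_map_measure_iff (by fun_prop) (hl i).aemeasurable).1 h
  · rw [(hl i).integral_eq]; simp
  · rw [key, (integral_pow_gaussianReal v).1]
  · rw [key, (integral_pow_gaussianReal v).2.1]
  · rw [key, (integral_pow_gaussianReal v).2.2]

namespace IsGaussianNoise

variable (h : IsGaussianNoise μ v ε)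
include h

theorem isProbabilityMeasure : IsProbabilityMeasure μ := h.indep.isProbabilityMeasure

theorem aemeasurable (i : ℕ) : AEMeasurable (ε i) μ := (h.memLp i).aemeasurable

theorem integrable_pow (i : ℕ) {k : ℕ} (hk : k ≤ 4) : Integrable (fun ω => ε i ω ^ k) μ := by
  have := h.isProbabilityMeasure
  have h1 : MemLp (ε i) k μ := (h.memLp i).mono_exponent (by exact_mod_cast hk)
  have h2 := h1.integrable_norm_pow'
  refine h2.mono' ((h.aemeasurable i).pow_const k).aestronglyMeasurable ?_
  filter_upwards with ω
  simp

theorem memLp_two (i : ℕ) : MemLp (ε i) 2 μ := by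
  have := h.isProbabilityMeasure
  exact (h.memLp i).mono_exponent (by norm_num)

theorem memLp_mul (i j : ℕ) : MemLp (fun ω => ε i ω * ε j ω) 2 μ := by
  have : ENNReal.HolderTriple 4 4 2 := ⟨by
    rw [← two_mul, show (4 : ENNReal) = 2 * 2 by norm_num,
      ENNReal.mul_inv (by simp) (by simp), ← mul_assoc,
      ENNReal.mul_inv_cancel (by simp) (by simp), one_mul]⟩
  exact (h.memLp j).mul (h.memLp i)

theorem memLp_linear (n : ℕ) (c : ℕ → ℝ) :
    MemLp (fun ω => ∑ k ∈ Finset.range n, c k * ε k ω) 2 μ :=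
  memLp_finsetSum _ fun k _ => (h.memLp_two k).const_mul (c k)

theorem memLp_quadratic (n : ℕ) (q : ℕ → ℕ → ℝ) :
    MemLp (fun ω => ∑ j ∈ Finset.range n, ∑ k ∈ Finset.range n, q j k * (ε j ω * ε k ω)) 2 μ :=
  memLp_finsetSum _ fun j _ => memLp_finsetSum _ fun k _ => (h.memLp_mul j k).const_mul (q j k)

/-- A function of `ε 0, …, ε (n - 1)` is independent of `ε n`. -/
theorem indepFun_past (n : ℕ) {F : (ℕ → ℝ) → ℝ} (hF : Measurable F) {Y : Ω → ℝ}
    (hY : ∀ ω, Y ω = F fun j => if j ∈ Finset.range n then ε j ω else 0) {G : ℝ → ℝ}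
    (hG : Measurable G) : IndepFun Y (fun ω => G (ε n ω)) μ := by
  have h1 := h.indep.indepFun_finset₀ (Finset.range n) {n} (by simp) h.aemeasurable
  have hφ : Measurable fun t : (Finset.range n → ℝ) =>
      F fun j => if hj : j ∈ Finset.range n then t ⟨j, hj⟩ else 0 := by
    refine hF.comp (measurable_pi_lambda _ fun j => ?_)
    by_cases hj : j ∈ Finset.range n
    · simpa [hj] using measurable_pi_apply _
    · simp [hj]
  have hψ : Measurable fun t : (({n} : Finset ℕ) → ℝ) => G (t ⟨n, by simp⟩) :=
    hG.comp (measurable_pi_apply _)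
  have h2 := h1.comp hφ hψ
  have e : Y = (fun t : (Finset.range n → ℝ) =>
      F fun j => if hj : j ∈ Finset.range n then t ⟨j, hj⟩ else 0) ∘
        fun ω (i : Finset.range n) => ε i ω := by
    funext ω
    simp [hY]
  rw [e]
  exact h2

theorem indepFun_linear (n : ℕ) (c : ℕ → ℝ) {G : ℝ → ℝ} (hG : Measurable G) :
    IndepFun (fun ω => ∑ k ∈ Finset.range n, c k * ε k ω) (fun ω => G (ε n ω)) μ :=
  h.indepFun_past n (F := fun y => ∑ k ∈ Finset.range n, c k * y k) (by fun_prop)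
    (fun ω => Finset.sum_congr rfl fun k hk => by simp only [if_pos hk]) hG

theorem integral_linear (n : ℕ) (c : ℕ → ℝ) :
    ∫ ω, ∑ k ∈ Finset.range n, c k * ε k ω ∂μ = 0 := by
  have := h.isProbabilityMeasure
  rw [integral_finsetSum _ fun k _ => ((h.memLp_two k).integrable (by norm_num)).const_mul _]
  simp [integral_const_mul, h.integral_eq]

theorem integral_linear_sq (n : ℕ) (c : ℕ → ℝ) :
    ∫ ω, (∑ k ∈ Finset.range n, c k * ε k ω) ^ 2 ∂μ = v * ∑ k ∈ Finset.range n, c k ^ 2 := by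
  have := h.isProbabilityMeasure
  induction n with
  | zero => simp
  | succ n ih =>
    have hL := h.memLp_linear n c
    have hi := h.indepFun_linear n c measurable_id
    have i1 := hi.integrable_mul (hL.integrable (by norm_num))
      ((h.memLp_two n).integrable (by norm_num))
    have e1 := hi.integral_mul_eq_mul_integral hL.aestronglyMeasurable
      (h.aemeasurable n).aestronglyMeasurable
    simp only [id, h.integral_eq, mul_zero] at e1
    have i2 := h.integrable_pow n (k := 2) (by norm_num)
    calc _ = ∫ ω, ((∑ k ∈ Finset.range n, c k * ε k ω) ^ 2 +
          (c n ^ 2 * ε n ω ^ 2 +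
            2 * c n * ((∑ k ∈ Finset.range n, c k * ε k ω) * ε n ω))) ∂μ := by
          refine integral_congr_ae (Filter.Eventually.of_forall fun ω => ?_)
          simp only [Finset.sum_range_succ]
          ring
      _ = v * ∑ k ∈ Finset.range n, c k ^ 2 + (c n ^ 2 * v + 2 * c n * 0) := by
          refine (integral_add hL.integrable_sq
            ((i2.const_mul (c n ^ 2)).add (i1.const_mul (2 * c n)))).trans ?_
          rw [ih]
          congr 1
          refine (integral_add (i2.const_mul (c n ^ 2)) (i1.const_mul (2 * c n))).trans ?_
          rw [integral_const_mul, integral_const_mul, h.integral_sq, ← e1]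
          rfl
      _ = _ := by rw [Finset.sum_range_succ]; ring

/-- Splitting off the last error `ε n` writes the centred form as `A + ε n * L + q n n * (ε n ^ 2 -
v)` with `A` and `L` functions of the past. The three terms are orthogonal: every cross term carries
a factor of mean zero, by the vanishing first and third moments. The fourth moment gives `Var (ε n ^
2) = 2 v ^ 2`, which is why diagonal and off-diagonal entries fit one formula. -/
theorem integral_quadratic_sub_sq (n : ℕ) (q : ℕ → ℕ → ℝ) (m : ℝ) :
    ∫ ω, (∑ j ∈ Finset.range n, ∑ k ∈ Finset.range n, q j k * (ε j ω * ε k ω) - m) ^ 2 ∂μ =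
      (v * ∑ j ∈ Finset.range n, q j j - m) ^ 2 +
        v ^ 2 / 2 * ∑ j ∈ Finset.range n, ∑ k ∈ Finset.range n, (q j k + q k j) ^ 2 := by
  have := h.isProbabilityMeasure
  -- The centring must vary: centring `ε n ^ 2` moves `q n n * v` into the constant.
  induction n generalizing m with
  | zero => simp
  | succ n ih =>
    set A : Ω → ℝ := fun ω =>
      ∑ j ∈ Finset.range n, ∑ k ∈ Finset.range n, q j k * (ε j ω * ε k ω) - (m - q n n * v)
      with hA
    set L : Ω → ℝ := fun ω => ∑ k ∈ Finset.range n, (q n k + q k n) * ε k ω with hLdef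
    have mA : MemLp A 2 μ := (h.memLp_quadratic n q).sub (memLp_const _)
    have mL : MemLp L 2 μ := h.memLp_linear n _
    have iA := mA.integrable (by norm_num)
    have iL := mL.integrable (by norm_num)
    have iAL : Integrable (fun ω => A ω * L ω) μ := mA.integrable_mul mL
    have eA : ∀ ω, A ω = (fun y : ℕ → ℝ => ∑ j ∈ Finset.range n, ∑ k ∈ Finset.range n,
        q j k * (y j * y k) - (m - q n n * v))
          fun j => if j ∈ Finset.range n then ε j ω else 0 := fun ω => by
      simp only [hA]
      congr 1
      exact Finset.sum_congr rfl fun j hj => Finset.sum_congr rfl fun k hk => by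
        simp only [if_pos hj, if_pos hk]
    have eL : ∀ ω, L ω = (fun y : ℕ → ℝ => ∑ k ∈ Finset.range n, (q n k + q k n) * y k)
          fun j => if j ∈ Finset.range n then ε j ω else 0 := fun ω =>
      Finset.sum_congr rfl fun k hk => by simp only [if_pos hk]
    have mFA : Measurable (fun y : ℕ → ℝ => ∑ j ∈ Finset.range n, ∑ k ∈ Finset.range n,
        q j k * (y j * y k) - (m - q n n * v)) := by fun_prop
    have mFL : Measurable (fun y : ℕ → ℝ => ∑ k ∈ Finset.range n, (q n k + q k n) * y k) := by
      fun_prop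
    have iε : ∀ k ≤ 4, Integrable (fun ω => ε n ω ^ k) μ := fun k hk => h.integrable_pow n hk
    have i1 : Integrable (ε n) μ := (h.memLp_two n).integrable (by norm_num)
    have iv : Integrable (fun ω => ε n ω ^ 2 - v) μ := (iε 2 (by norm_num)).sub (integrable_const _)
    have ic : Integrable (fun ω => ε n ω ^ 3 - v * ε n ω) μ :=
      (iε 3 (by norm_num)).sub (i1.const_mul _)
    have zv : ∫ ω, (ε n ω ^ 2 - v) ∂μ = 0 := by
      rw [integral_sub (iε 2 (by norm_num)) (integrable_const _), h.integral_sq]; simp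
    have zc : ∫ ω, (ε n ω ^ 3 - v * ε n ω) ∂μ = 0 := by
      rw [integral_sub (iε 3 (by norm_num)) (i1.const_mul _), integral_const_mul,
        h.integral_cube, h.integral_eq]; simp
    have zq : ∫ ω, (ε n ω ^ 2 - v) ^ 2 ∂μ = 2 * v ^ 2 := by
      calc _ = ∫ ω, (ε n ω ^ 4 - 2 * v * ε n ω ^ 2 + v ^ 2) ∂μ := by congr 1; funext ω; ring
        _ = 2 * v ^ 2 := by
          refine (integral_add ((iε 4 le_rfl).sub ((iε 2 (by norm_num)).const_mul (2 * v)))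
            (integrable_const _)).trans ?_
          refine (congrArg₂ _ (integral_sub (iε 4 le_rfl)
            ((iε 2 (by norm_num)).const_mul (2 * v))) rfl).trans ?_
          rw [integral_const_mul, h.integral_four, h.integral_sq]
          simp
          ring
    have iq : Integrable (fun ω => (ε n ω ^ 2 - v) ^ 2) μ := by
      have : (fun ω => (ε n ω ^ 2 - v) ^ 2) = fun ω => ε n ω ^ 4 - 2 * v * ε n ω ^ 2 + v ^ 2 := by
        funext ω; ring
      rw [this]
      exact ((iε 4 le_rfl).sub ((iε 2 (by norm_num)).const_mul _)).add (integrable_const _)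
    have ind1 : IndepFun (fun ω => L ω ^ 2) (fun ω => ε n ω ^ 2) μ :=
      h.indepFun_past n (mFL.pow_const 2) (fun ω => by rw [eL]) (G := fun x => x ^ 2) (by fun_prop)
    have ind2 : IndepFun (fun ω => A ω * L ω) (ε n) μ :=
      h.indepFun_past n (mFA.mul mFL) (fun ω => by rw [eA, eL]; rfl) measurable_id
    have ind3 : IndepFun A (fun ω => ε n ω ^ 2 - v) μ :=
      h.indepFun_past n mFA eA (G := fun x => x ^ 2 - v) (by fun_prop)
    have ind4 : IndepFun L (fun ω => ε n ω ^ 3 - v * ε n ω) μ :=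
      h.indepFun_past n mFL eL (G := fun x => x ^ 3 - v * x) (by fun_prop)
    have j1 : Integrable (fun ω => L ω ^ 2 * ε n ω ^ 2) μ :=
      ind1.integrable_mul mL.integrable_sq (iε 2 (by norm_num))
    have j2 : Integrable (fun ω => A ω * L ω * ε n ω) μ := ind2.integrable_mul iAL i1
    have j3 : Integrable (fun ω => A ω * (ε n ω ^ 2 - v)) μ := ind3.integrable_mul iA iv
    have j4 : Integrable (fun ω => L ω * (ε n ω ^ 3 - v * ε n ω)) μ := ind4.integrable_mul iL ic
    have z1 : ∫ ω, L ω ^ 2 * ε n ω ^ 2 ∂μ = (∫ ω, L ω ^ 2 ∂μ) * v := by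
      rw [← h.integral_sq n]
      exact ind1.integral_mul_eq_mul_integral mL.integrable_sq.aestronglyMeasurable
        (iε 2 (by norm_num)).aestronglyMeasurable
    have z2 : ∫ ω, A ω * L ω * ε n ω ∂μ = 0 := by
      have := ind2.integral_mul_eq_mul_integral iAL.aestronglyMeasurable i1.aestronglyMeasurable
      rw [h.integral_eq, mul_zero] at this
      exact this
    have z3 : ∫ ω, A ω * (ε n ω ^ 2 - v) ∂μ = 0 := by
      have := ind3.integral_mul_eq_mul_integral iA.aestronglyMeasurable iv.aestronglyMeasurable
      rw [zv, mul_zero] at this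
      exact this
    have z4 : ∫ ω, L ω * (ε n ω ^ 3 - v * ε n ω) ∂μ = 0 := by
      have := ind4.integral_mul_eq_mul_integral iL.aestronglyMeasurable ic.aestronglyMeasurable
      rw [zc, mul_zero] at this
      exact this
    have decomp : ∀ ω, ∑ j ∈ Finset.range (n + 1), ∑ k ∈ Finset.range (n + 1),
        q j k * (ε j ω * ε k ω) - m = A ω + ε n ω * L ω + q n n * (ε n ω ^ 2 - v) := fun ω => by
      simp only [hA, hLdef, Finset.sum_range_succ, Finset.sum_add_distrib, Finset.mul_sum,
        add_mul, mul_add]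
      have s1 : ∑ k ∈ Finset.range n, q n k * (ε n ω * ε k ω) =
          ∑ k ∈ Finset.range n, ε n ω * (q n k * ε k ω) :=
        Finset.sum_congr rfl fun _ _ => by ring
      have s2 : ∑ k ∈ Finset.range n, q k n * (ε k ω * ε n ω) =
          ∑ k ∈ Finset.range n, ε n ω * (q k n * ε k ω) :=
        Finset.sum_congr rfl fun _ _ => by ring
      rw [s1, s2]
      ring
    calc _ = ∫ ω, (A ω ^ 2 + (L ω ^ 2 * ε n ω ^ 2 + (q n n ^ 2 * (ε n ω ^ 2 - v) ^ 2 +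
          (2 * (A ω * L ω * ε n ω) + (2 * q n n * (A ω * (ε n ω ^ 2 - v)) +
            2 * q n n * (L ω * (ε n ω ^ 3 - v * ε n ω))))))) ∂μ := by
          refine integral_congr_ae (Filter.Eventually.of_forall fun ω => ?_)
          simp only [decomp]
          ring
      _ = ∫ ω, A ω ^ 2 ∂μ + ((∫ ω, L ω ^ 2 ∂μ) * v + (q n n ^ 2 * (2 * v ^ 2) +
          (2 * 0 + (2 * q n n * 0 + 2 * q n n * 0)))) := by
          have k5 := (j3.const_mul (2 * q n n)).add (j4.const_mul (2 * q n n))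
          have k4 := (j2.const_mul 2).add k5
          have k3 := (iq.const_mul (q n n ^ 2)).add k4
          have k2 := j1.add k3
          refine (integral_add mA.integrable_sq k2).trans ?_
          congr 1
          refine (integral_add j1 k3).trans ?_
          congr 1
          refine (integral_add (iq.const_mul (q n n ^ 2)) k4).trans ?_
          rw [integral_const_mul, zq]
          congr 1
          refine (integral_add (j2.const_mul 2) k5).trans ?_
          rw [integral_const_mul, z2]
          congr 1
          refine (integral_add (j3.const_mul (2 * q n n)) (j4.const_mul (2 * q n n))).trans ?_
          rw [integral_const_mul, integral_const_mul, z3, z4]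
      _ = _ := by
          have s : ∑ k ∈ Finset.range n, (q k n + q n k) ^ 2 =
              ∑ k ∈ Finset.range n, (q n k + q k n) ^ 2 :=
            Finset.sum_congr rfl fun _ _ => by ring
          rw [show ∫ ω, A ω ^ 2 ∂μ = _ from ih (m - q n n * v),
            show ∫ ω, L ω ^ 2 ∂μ = _ from h.integral_linear_sq n fun k => q n k + q k n]
          simp only [Finset.sum_range_succ, Finset.sum_add_distrib]
          rw [s]
          ring

end IsGaussianNoise

end Noise

/-! ### Coefficients of the iterates and of the estimator. -/

/-- The coefficient of `e (j + 1)` in the iterate `X_i`. -/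
noncomputable def coef (η α : ℝ) : ℕ → ℕ → ℝ
  | 0, _ => 0
  | i + 1, j =>
      (1 - stepSize η α (i + 1)) * coef η α i j + if j = i then stepSize η α (i + 1) else 0

/-- The coefficient of `e (k + 1)` in the batch sum `W_i`. -/
noncomputable def batchCoef (η α C : ℝ) (i k : ℕ) : ℝ :=
  ∑ m ∈ Finset.Ico (batchStart α C i) i, coef η α m k

/-- The coefficient of `e (k + 1)` in the part `X_1 + ⋯ + X_{t_i - 1}` cut off from the batch. -/
noncomputable def cutCoef (η α C : ℝ) (i k : ℕ) : ℝ :=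
  ∑ m ∈ Finset.Ico 1 (min (batchStart α C i) i), coef η α m k

/-- The coefficient of `e (j + 1) * e (k + 1)` in the quadratic form `n σ̂_n`. -/
noncomputable def quadCoef (η α C : ℝ) (n j k : ℕ) : ℝ :=
  ∑ i ∈ Finset.Icc 1 n, coef η α i j * (coef η α i k + 2 * batchCoef η α C i k)

section Algebra

variable (η α C : ℝ)

theorem coef_succ (i j : ℕ) : coef η α (i + 1) j =
    (1 - stepSize η α (i + 1)) * coef η α i j + if j = i then stepSize η α (i + 1) else 0 := rfl

theorem coef_eq_zero {i j : ℕ} (h : i ≤ j) : coef η α i j = 0 := by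
  induction i with
  | zero => rfl
  | succ i ih => rw [coef_succ, ih (by omega), if_neg (by omega)]; simp

theorem coef_succ_self (i : ℕ) : coef η α (i + 1) i = stepSize η α (i + 1) := by
  rw [coef_succ, coef_eq_zero η α le_rfl]; simp

theorem coef_succ_of_lt {i j : ℕ} (h : j < i) :
    coef η α (i + 1) j = (1 - stepSize η α (i + 1)) * coef η α i j := by
  rw [coef_succ, if_neg (by omega), add_zero]

theorem coef_eq_prod {s i j : ℕ} (hj : j < s) (hs : s ≤ i) :
    coef η α i j = (∏ k ∈ Finset.Ico s i, (1 - stepSize η α (k + 1))) * coef η α s j := by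
  induction i, hs using Nat.le_induction with
  | base => simp
  | succ i hi ih =>
    rw [coef_succ_of_lt η α (by omega), ih, Finset.prod_Ico_succ_top hi]
    ring

variable {Ω : Type*} (e : ℕ → Ω → ℝ)

theorem iterate_eq_sum (n : ℕ) (ω : Ω) {i : ℕ} (hi : i ≤ n) :
    iterate η α e i ω = ∑ j ∈ Finset.range n, coef η α i j * e (j + 1) ω := by
  induction i with
  | zero => simp [iterate, coef]
  | succ i ih =>
    rw [iterate, ih (by omega)]
    simp only [coef_succ, add_mul, Finset.sum_add_distrib, ite_mul, zero_mul,
      Finset.sum_ite_eq', Finset.mem_range, if_pos (show i < n by omega), Finset.mul_sum, mul_assoc]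

theorem batchSum_eq_sum (n : ℕ) (ω : Ω) {i : ℕ} (hi : i ≤ n) :
    batchSum η α C e i ω = ∑ k ∈ Finset.range n, batchCoef η α C i k * e (k + 1) ω := by
  simp only [batchSum, batchCoef, Finset.sum_mul]
  rw [Finset.sum_comm]
  refine Finset.sum_congr rfl fun m hm => iterate_eq_sum η α e n ω ?_
  have := (Finset.mem_Ico.1 hm).2
  omega

theorem sigmaHat_eq_sum (n : ℕ) (ω : Ω) :
    sigmaHat η α C e n ω = (n : ℝ)⁻¹ * ∑ j ∈ Finset.range n, ∑ k ∈ Finset.range n,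
      quadCoef η α C n j k * (e (j + 1) ω * e (k + 1) ω) := by
  have h : ∀ i ∈ Finset.Icc 1 n, iterate η α e i ω ^ 2 +
      2 * iterate η α e i ω * batchSum η α C e i ω =
      ∑ j ∈ Finset.range n, ∑ k ∈ Finset.range n, coef η α i j *
        (coef η α i k + 2 * batchCoef η α C i k) * (e (j + 1) ω * e (k + 1) ω) := fun i hi => by
    have hin := (Finset.mem_Icc.1 hi).2
    calc _ = iterate η α e i ω * (iterate η α e i ω + 2 * batchSum η α C e i ω) := by ring
      _ = (∑ j ∈ Finset.range n, coef η α i j * e (j + 1) ω) *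
          ∑ k ∈ Finset.range n, (coef η α i k + 2 * batchCoef η α C i k) * e (k + 1) ω := by
        rw [iterate_eq_sum η α e n ω hin, batchSum_eq_sum η α C e n ω hin]
        simp only [add_mul, Finset.sum_add_distrib, Finset.mul_sum, mul_assoc]
      _ = _ := by
        rw [Finset.sum_mul_sum]
        exact Finset.sum_congr rfl fun _ _ => Finset.sum_congr rfl fun _ _ => by ring
  rw [sigmaHat, Finset.sum_congr rfl h]
  congr 1
  rw [Finset.sum_comm]
  refine Finset.sum_congr rfl fun j _ => ?_
  rw [Finset.sum_comm]
  exact Finset.sum_congr rfl fun k _ => by rw [quadCoef, Finset.sum_mul]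

theorem average_eq_sum (n : ℕ) (ω : Ω) :
    average η α e n ω = (n : ℝ)⁻¹ * ∑ j ∈ Finset.range n,
      (∑ i ∈ Finset.Icc 1 n, coef η α i j) * e (j + 1) ω := by
  rw [average]
  congr 1
  simp only [Finset.sum_mul]
  rw [Finset.sum_comm]
  exact Finset.sum_congr rfl fun i hi => iterate_eq_sum η α e n ω (Finset.mem_Icc.1 hi).2

/-- This puts the squared total into the shape of the estimator, with the whole past in place of the
batch, so that comparing the two leaves only the part cut off. -/
theorem sum_Icc_sq (x : ℕ → ℝ) (n : ℕ) : (∑ i ∈ Finset.Icc 1 n, x i) ^ 2 =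
    ∑ i ∈ Finset.Icc 1 n, x i * (x i + 2 * ∑ m ∈ Finset.Ico 1 i, x m) := by
  induction n with
  | zero => simp
  | succ n ih =>
    rw [Finset.sum_Icc_succ_top (by omega), Finset.sum_Icc_succ_top (by omega), ← ih,
      show Finset.Ico 1 (n + 1) = Finset.Icc 1 n from rfl]
    ring

theorem sum_Ico_eq_cutCoef_add (i j : ℕ) :
    ∑ m ∈ Finset.Ico 1 i, coef η α m j = cutCoef η α C i j + batchCoef η α C i j := by
  have h1 : 1 ≤ batchStart α C i := le_max_left _ _
  rw [cutCoef, batchCoef]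
  -- If `ℓ_i = 0` the batch start is `i + 1`; the `min` in `cutCoef` then keeps the cut part below
  -- `i`.
  rcases le_total (batchStart α C i) i with h | h
  · rw [min_eq_left h, Finset.sum_Ico_consecutive _ h1 h]
  · rw [min_eq_right h, Finset.Ico_eq_empty_of_le h]; simp

/-- The bias of `n σ̂_n` comes from the covariances cut off by the batches. -/
theorem sum_quadCoef_diag_sub (n : ℕ) : ∑ j ∈ Finset.range n, quadCoef η α C n j j -
    ∑ j ∈ Finset.range n, (∑ i ∈ Finset.Icc 1 n, coef η α i j) ^ 2 =
    -2 * ∑ i ∈ Finset.Icc 1 n, ∑ j ∈ Finset.range n, coef η α i j * cutCoef η α C i j := by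
  rw [Finset.sum_comm (s := Finset.Icc 1 n), ← Finset.sum_sub_distrib, Finset.mul_sum]
  refine Finset.sum_congr rfl fun j _ => ?_
  rw [sum_Icc_sq, quadCoef, ← Finset.sum_sub_distrib, Finset.mul_sum]
  refine Finset.sum_congr rfl fun i _ => ?_
  rw [sum_Ico_eq_cutCoef_add η α C]
  ring

end Algebra

/-- Bias–variance decomposition. The variance `σ_n` is itself `v / n` times the squared column sums
of `coef`, so the bias is the diagonal difference computed in `sum_quadCoef_diag_sub`. -/
theorem mse_eq {Ω : Type*} [MeasurableSpace Ω] {μ : Measure Ω} {v : ℝ} {e : ℕ → Ω → ℝ}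
    (h : IsGaussianNoise μ v fun i => e (i + 1)) (η α C : ℝ) {n : ℕ} (hn : n ≠ 0) :
    mse μ η α C e n = ((n : ℝ)⁻¹) ^ 2 *
      (4 * v ^ 2 * (∑ i ∈ Finset.Icc 1 n, ∑ j ∈ Finset.range n,
          coef η α i j * cutCoef η α C i j) ^ 2 +
        v ^ 2 / 2 * ∑ j ∈ Finset.range n, ∑ k ∈ Finset.range n,
          (quadCoef η α C n j k + quadCoef η α C n k j) ^ 2) := by
  have := h.isProbabilityMeasure
  have hn' : (n : ℝ) ≠ 0 := by exact_mod_cast hn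
  have hs : sigmaN μ η α e n = (n : ℝ)⁻¹ *
      (v * ∑ j ∈ Finset.range n, (∑ i ∈ Finset.Icc 1 n, coef η α i j) ^ 2) := by
    rw [sigmaN, variance_const_mul, Real.sq_sqrt (Nat.cast_nonneg n)]
    have e1 : average η α e n = fun ω => (n : ℝ)⁻¹ * ∑ j ∈ Finset.range n,
      (∑ i ∈ Finset.Icc 1 n, coef η α i j) * e (j + 1) ω := funext (average_eq_sum η α e n)
    rw [e1, variance_const_mul, variance_of_integral_eq_zero
      (h.memLp_linear n _).aestronglyMeasurable.aemeasurable (h.integral_linear n _),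
      h.integral_linear_sq n]
    field_simp
  have hm : mse μ η α C e n = ∫ ω, ((n : ℝ)⁻¹) ^ 2 * (∑ j ∈ Finset.range n,
      ∑ k ∈ Finset.range n, quadCoef η α C n j k * (e (j + 1) ω * e (k + 1) ω) -
        v * ∑ j ∈ Finset.range n, (∑ i ∈ Finset.Icc 1 n, coef η α i j) ^ 2) ^ 2 ∂μ := by
    refine integral_congr_ae (Filter.Eventually.of_forall fun ω => ?_)
    simp only [sigmaHat_eq_sum, hs]
    ring
  have hd := sum_quadCoef_diag_sub η α C n
  rw [hm, integral_const_mul, h.integral_quadratic_sub_sq n, ← mul_sub, hd]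
  ring

/-! ### Bounded row and column sums of the coefficients. -/

section Bounds

open Filter Topology

variable {η α : ℝ}

theorem stepSize_pos (hη : 0 < η) {i : ℕ} (hi : 1 ≤ i) : 0 < stepSize η α i :=
  mul_pos hη (Real.rpow_pos_of_pos (by exact_mod_cast hi) _)

theorem stepSize_anti (hη : 0 < η) (hα : 0 < α) {i k : ℕ} (hi : 1 ≤ i) (hk : i ≤ k) :
    stepSize η α k ≤ stepSize η α i :=
  mul_le_mul_of_nonneg_left (Real.rpow_le_rpow_of_nonpos (by exact_mod_cast hi)
    (by exact_mod_cast hk) (by linarith)) hη.le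

theorem stepSize_le (hη : 0 < η) (hα : 0 < α) {i : ℕ} (hi : 1 ≤ i) : stepSize η α i ≤ η := by
  simpa [stepSize] using stepSize_anti hη hα le_rfl hi

theorem exists_stepSize_le (η : ℝ) (hα : 0 < α) {δ : ℝ} (hδ : 0 < δ) :
    ∃ N : ℕ, 1 ≤ N ∧ ∀ i, N ≤ i → stepSize η α i ≤ δ := by
  have h : Tendsto (fun i : ℕ => stepSize η α i) atTop (𝓝 (η * 0)) :=
    ((tendsto_rpow_neg_atTop hα).comp tendsto_natCast_atTop_atTop).const_mul η
  rw [mul_zero] at h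
  obtain ⟨N, hN⟩ := eventually_atTop.1 (h.eventually_le_const hδ)
  exact ⟨max N 1, le_max_right _ _, fun i hi => hN i ((le_max_left _ _).trans hi)⟩

theorem abs_one_sub_stepSize_le (hη : 0 < η) (hα : 0 < α) (i : ℕ) :
    |1 - stepSize η α (i + 1)| ≤ 1 + η := by
  have h1 := stepSize_pos (α := α) hη (Nat.le_add_left 1 i)
  have h2 := stepSize_le hη hα (Nat.le_add_left 1 i)
  rw [abs_le]
  constructor <;> linarith

theorem sum_abs_coef_succ_le (hη : 0 < η) (i : ℕ) :
    ∑ j ∈ Finset.range (i + 1), |coef η α (i + 1) j| ≤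
      |1 - stepSize η α (i + 1)| * ∑ j ∈ Finset.range i, |coef η α i j| +
        stepSize η α (i + 1) := by
  rw [Finset.sum_range_succ, coef_succ_self, abs_of_pos (stepSize_pos hη (by omega)),
    Finset.mul_sum]
  gcongr with j hj
  rw [coef_succ_of_lt η α (Finset.mem_range.1 hj), abs_mul]

/-- Once `η_i ≤ 1`, the recursion bounds the next row sum by a convex combination of the previous
one and `1`, so any bound `R ≥ 1` persists. The finitely many earlier rows are added into `R`. -/
theorem exists_row_bound (hη : 0 < η) (hα : 0 < α) :
    ∃ R : ℝ, 1 ≤ R ∧ ∀ (i : ℕ) (s : Finset ℕ), ∑ j ∈ s, |coef η α i j| ≤ R := by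
  obtain ⟨N, hN1, hN⟩ := exists_stepSize_le η hα one_pos
  set R := 1 + ∑ i ∈ Finset.range (N + 1), ∑ j ∈ Finset.range i, |coef η α i j| with hR
  have h0 : ∀ i, 0 ≤ ∑ j ∈ Finset.range i, |coef η α i j| := fun i =>
    Finset.sum_nonneg fun _ _ => abs_nonneg _
  have hR1 : 1 ≤ R := by
    have := Finset.sum_nonneg (s := Finset.range (N + 1)) fun i _ => h0 i
    linarith
  have key : ∀ i, ∑ j ∈ Finset.range i, |coef η α i j| ≤ R := by
    intro i
    rcases le_total i N with hi | hi
    · have := Finset.single_le_sum (f := fun i => ∑ j ∈ Finset.range i, |coef η α i j|)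
        (fun i _ => h0 i) (Finset.mem_range.2 (by omega : i < N + 1))
      linarith
    · induction i, hi using Nat.le_induction with
      | base =>
        have := Finset.single_le_sum (f := fun i => ∑ j ∈ Finset.range i, |coef η α i j|)
          (fun i _ => h0 i) (Finset.mem_range.2 (by omega : N < N + 1))
        linarith
      | succ i hi ih =>
        have h1 := stepSize_pos (α := α) hη (by omega : 1 ≤ i + 1)
        have h2 := hN (i + 1) (by omega)
        refine (sum_abs_coef_succ_le hη i).trans ?_
        rw [abs_of_nonneg (by linarith)]
        nlinarith
  refine ⟨R, hR1, fun i s => (le_trans ?_ (key i))⟩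
  rw [← Finset.sum_filter_add_sum_filter_not s (fun j => j < i)]
  have z : ∑ j ∈ s with ¬ j < i, |coef η α i j| = 0 := Finset.sum_eq_zero fun j hj => by
    rw [coef_eq_zero η α (by simpa using (Finset.mem_filter.1 hj).2), abs_zero]
  rw [z, add_zero]
  refine Finset.sum_le_sum_of_subset_of_nonneg (fun j hj => ?_) fun _ _ _ => abs_nonneg _
  exact Finset.mem_range.2 (Finset.mem_filter.1 hj).2

theorem add_one_rpow_le (hα : 0 < α) (hα1 : α ≤ 1) {x : ℝ} (hx : 0 < x) :
    (x + 1) ^ α ≤ x ^ α + x ^ (α - 1) := by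
  have h : (1 + 1 / x) ^ α ≤ 1 + α * (1 / x) :=
    rpow_one_add_le_one_add_mul_self (by have := one_div_pos.2 hx; linarith) hα.le hα1
  calc (x + 1) ^ α = x ^ α * (1 + 1 / x) ^ α := by
        rw [← Real.mul_rpow hx.le (by positivity)]; congr 1; field_simp
    _ ≤ x ^ α * (1 + 1 * (1 / x)) := by
        gcongr
        refine h.trans ?_
        gcongr
    _ = x ^ α + x ^ (α - 1) := by rw [Real.rpow_sub_one hx.ne']; ring

/-- Together with `(n + 1) ^ α * |coef n j|`, the column sums of the coefficients
eventually do not increase. -/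
theorem exists_potential (hη : 0 < η) (hα : α ∈ Set.Ioo (0 : ℝ) 1) :
    ∃ N : ℕ, ∀ n : ℕ, N ≤ n → |1 - stepSize η α (n + 1)| *
      (1 + 2 / η * ((n : ℝ) + 2) ^ α) ≤ 2 / η * ((n : ℝ) + 1) ^ α := by
  obtain ⟨hα0, hα1⟩ := hα
  obtain ⟨N, hN1, hN⟩ := exists_stepSize_le η hα0 one_pos
  have h : Tendsto (fun i : ℕ => 2 / η * (i : ℝ) ^ (-(1 - α))) atTop (𝓝 (2 / η * 0)) :=
    ((tendsto_rpow_neg_atTop (by linarith)).comp tendsto_natCast_atTop_atTop).const_mul _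
  rw [mul_zero] at h
  obtain ⟨M, hM⟩ := eventually_atTop.1 (h.eventually_le_const one_pos)
  refine ⟨max N M, fun n hn => ?_⟩
  have h1 := stepSize_pos (α := α) hη (by omega : 1 ≤ n + 1)
  have h2 := hN (n + 1) (by omega)
  have h3 := hM (n + 1) (by omega)
  rw [abs_of_nonneg (by linarith)]
  push_cast at h3
  set x : ℝ := (n : ℝ) + 1 with hx
  have hx0 : 0 < x := by positivity
  have e1 : -(1 - α) = α - 1 := by ring
  rw [e1] at h3
  have h4 := add_one_rpow_le hα0 hα1.le hx0
  have h5 : (n : ℝ) + 2 = x + 1 := by rw [hx]; ring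
  rw [h5]
  have h6 : x ^ α ≤ (x + 1) ^ α := Real.rpow_le_rpow hx0.le (by linarith) hα0.le
  -- With weight `2 / η` the contraction lowers the potential by at least `2`: one unit pays for the
  -- new term of the column sum, the other for the growth of the weight from `x ^ α` to `(x + 1) ^
  -- α`.
  have h7 : η ≤ stepSize η α (n + 1) * (x + 1) ^ α := by
    calc η = η * x ^ (-α) * x ^ α := by
          rw [mul_assoc, ← Real.rpow_add hx0]; simp
      _ ≤ stepSize η α (n + 1) * (x + 1) ^ α := by
          rw [stepSize]
          push_cast
          gcongr
  have h8 : 2 / η * η = 2 := by field_simp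
  have h9 : 0 < 2 / η := by positivity
  have h10 := mul_le_mul_of_nonneg_left h7 h9.le
  have h11 := mul_le_mul_of_nonneg_left h4 h9.le
  nlinarith

/-- A Lyapunov argument: `V n j`, the column sum so far plus a reserve for the future, does not
increase in `n` after time `N` once column `j` has started. It then suffices to bound its starting
value. -/
theorem exists_column_bound (hη : 0 < η) (hα : α ∈ Set.Ioo (0 : ℝ) 1) :
    ∃ R : ℝ, 1 ≤ R ∧ ∀ (j : ℕ) (s : Finset ℕ), ∑ i ∈ s, |coef η α i j| ≤ R := by
  obtain ⟨N, hN⟩ := exists_potential hη hα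
  set V : ℕ → ℕ → ℝ := fun n j => ∑ i ∈ Finset.range (n + 1), |coef η α i j| +
    2 / η * ((n : ℝ) + 1) ^ α * |coef η α n j| with hV
  have hV0 : ∀ n j, 0 ≤ V n j := fun n j => by
    have := Finset.sum_nonneg (s := Finset.range (n + 1)) fun i _ => abs_nonneg (coef η α i j)
    simp only [hV]
    positivity
  -- The middle term bounds the potential of a column starting after `N`; the sum covers columns
  -- already started at `N`.
  set R := 1 + η * (1 + 2 / η * 2) + ∑ j ∈ Finset.range N, V N j with hR
  have hS0 : 0 ≤ ∑ j ∈ Finset.range N, V N j := Finset.sum_nonneg fun j _ => hV0 N j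
  have hη2 : 0 < η * (1 + 2 / η * 2) := by positivity
  have hR1 : 1 ≤ R := by linarith
  have hzero : ∀ n j, n ≤ j → V n j = 0 := fun n j hj => by
    simp only [hV]
    rw [coef_eq_zero η α hj, Finset.sum_eq_zero fun i hi => ?_]
    · simp
    · rw [coef_eq_zero η α (by have := Finset.mem_range.1 hi; omega), abs_zero]
  have key : ∀ n, N ≤ n → ∀ j, V n j ≤ R := by
    intro n hn
    induction n, hn using Nat.le_induction with
    | base =>
      intro j
      rcases lt_or_ge j N with hj | hj
      · have := Finset.single_le_sum (f := fun j => V N j) (fun j _ => hV0 N j)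
          (Finset.mem_range.2 hj)
        linarith
      · rw [hzero N j hj]; linarith
    | succ n hn ih =>
      intro j
      rcases lt_trichotomy j n with hj | hj | hj
      · refine le_trans ?_ (ih j)
        have h1 := mul_le_mul_of_nonneg_right (hN n hn) (abs_nonneg (coef η α n j))
        simp only [hV]
        rw [Finset.sum_range_succ _ (n + 1), coef_succ_of_lt η α hj, abs_mul]
        push_cast
        rw [show (n : ℝ) + 1 + 1 = n + 2 by ring]
        linarith
      · subst hj
        simp only [hV]
        rw [Finset.sum_range_succ, coef_succ_self, abs_of_pos (stepSize_pos hη (by omega)),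
          Finset.sum_eq_zero fun i hi => by
            rw [coef_eq_zero η α (by have := Finset.mem_range.1 hi; omega), abs_zero]]
        have h1 : stepSize η α (j + 1) * ((j : ℝ) + 1) ^ α = η := by
          rw [stepSize, mul_assoc]
          push_cast
          rw [← Real.rpow_add (by positivity)]
          simp
        have h2 : ((j : ℝ) + 1 + 1) ^ α ≤ 2 * ((j : ℝ) + 1) ^ α := by
          calc ((j : ℝ) + 1 + 1) ^ α ≤ (2 * ((j : ℝ) + 1)) ^ α := by
                have := hα.1
                gcongr
                linarith [(Nat.cast_nonneg j : (0 : ℝ) ≤ j)]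
            _ = 2 ^ α * ((j : ℝ) + 1) ^ α := Real.mul_rpow (by norm_num) (by positivity)
            _ ≤ 2 * ((j : ℝ) + 1) ^ α := by
                gcongr
                calc (2 : ℝ) ^ α ≤ 2 ^ (1 : ℝ) :=
                      Real.rpow_le_rpow_of_exponent_le (by norm_num) hα.2.le
                  _ = 2 := Real.rpow_one 2
        have h3 := stepSize_pos (α := α) hη (by omega : 1 ≤ j + 1)
        have h4 := stepSize_le hη hα.1 (by omega : 1 ≤ j + 1)
        have h5 : 2 / η * ((j : ℝ) + 1 + 1) ^ α * stepSize η α (j + 1) ≤ 2 / η * 2 * η := by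
          calc _ ≤ 2 / η * (2 * ((j : ℝ) + 1) ^ α) * stepSize η α (j + 1) := by gcongr
            _ = 2 / η * 2 * (stepSize η α (j + 1) * ((j : ℝ) + 1) ^ α) := by ring
            _ = 2 / η * 2 * η := by rw [h1]
        push_cast
        linarith
      · rw [hzero _ _ (by omega)]; linarith
  refine ⟨R, hR1, fun j s => ?_⟩
  refine le_trans ?_ (key (N + s.sup id) (by omega) j)
  have h1 : ∑ i ∈ s, |coef η α i j| ≤ ∑ i ∈ Finset.range (N + s.sup id + 1), |coef η α i j| := by
    refine Finset.sum_le_sum_of_subset_of_nonneg (fun i hi => ?_) fun _ _ _ => abs_nonneg _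
    have : i ≤ s.sup id := Finset.le_sup (f := id) hi
    exact Finset.mem_range.2 (by omega)
  refine h1.trans (le_add_of_nonneg_right ?_)
  positivity

end Bounds

/-! ### Bounded bias and the upper bound on the variance. -/

section Upper

variable {η α C : ℝ}

theorem exists_abs_prod_le (hη : 0 < η) (hα : 0 < α) : ∃ D : ℝ, 0 < D ∧ ∀ s i : ℕ,
    |∏ k ∈ Finset.Ico s i, (1 - stepSize η α (k + 1))| ≤
      D * Real.exp (-∑ k ∈ Finset.Ico s i, stepSize η α (k + 1)) := by
  obtain ⟨N, -, hN⟩ := exists_stepSize_le η hα one_pos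
  -- `1 - x ≤ exp (-x)` needs `x ≤ 1` to survive the absolute value; each of the at most `N` factors
  -- with a possibly larger step costs `c` instead.
  set c := (1 + η) * Real.exp η with hc
  have hc1 : 1 ≤ c := by
    have := Real.one_le_exp hη.le
    nlinarith
  refine ⟨c ^ N, by positivity, fun s i => ?_⟩
  have hf : ∀ k, |1 - stepSize η α (k + 1)| ≤
      (if k < N then c else 1) * Real.exp (-stepSize η α (k + 1)) := fun k => by
    split_ifs with hk
    · refine (abs_one_sub_stepSize_le hη hα k).trans ?_
      rw [hc, mul_assoc, ← Real.exp_add]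
      refine le_mul_of_one_le_right (by positivity) (Real.one_le_exp ?_)
      linarith [stepSize_le hη hα (Nat.le_add_left 1 k)]
    · rw [abs_of_nonneg (by linarith [hN (k + 1) (by omega)]), one_mul]
      linarith [Real.add_one_le_exp (-stepSize η α (k + 1))]
  calc _ = ∏ k ∈ Finset.Ico s i, |1 - stepSize η α (k + 1)| := Finset.abs_prod _ _
    _ ≤ ∏ k ∈ Finset.Ico s i, (if k < N then c else 1) * Real.exp (-stepSize η α (k + 1)) :=
        Finset.prod_le_prod (fun _ _ => abs_nonneg _) fun k _ => hf k
    _ = c ^ (Finset.card {k ∈ Finset.Ico s i | k < N}) *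
          Real.exp (-∑ k ∈ Finset.Ico s i, stepSize η α (k + 1)) := by
        rw [Finset.prod_mul_distrib, ← Real.exp_sum, Finset.sum_neg_distrib, Finset.prod_ite,
          Finset.prod_const, Finset.prod_const_one, mul_one]
    _ ≤ _ := by
        gcongr
        calc _ ≤ (Finset.range N).card := Finset.card_le_card fun k hk =>
              Finset.mem_range.2 (Finset.mem_filter.1 hk).2
          _ = N := Finset.card_range N

/-- About `C i ^ α log i` steps, each at least `η i ^ (-α)`. The floor and the endpoint of the batch
lose at most two steps, hence `2 * η`; a start above `1` excludes the truncated batches. -/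
theorem le_sum_stepSize (hη : 0 < η) (hα : 0 < α) {i : ℕ} (hi : 1 ≤ i)
    (hs : 1 < min (batchStart α C i) i) :
    η * C * Real.log i - 2 * η ≤
      ∑ k ∈ Finset.Ico (min (batchStart α C i) i) i, stepSize η α (k + 1) := by
  set s := min (batchStart α C i) i with hsdef
  have hi0 : (0 : ℝ) < i := by exact_mod_cast hi
  have h1 : batchSize α C i ≤ (i - s) + 1 := by
    have h2 : 1 < batchStart α C i := lt_of_lt_of_le hs (min_le_left _ _)
    unfold batchStart at hsdef h2
    omega
  have h3 : C * (i : ℝ) ^ α * Real.log i ≤ ((i - s : ℕ) : ℝ) + 2 := by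
    have h4 := Nat.lt_floor_add_one (C * (i : ℝ) ^ α * Real.log i)
    have h5 : ((batchSize α C i : ℕ) : ℝ) ≤ ((i - s : ℕ) : ℝ) + 1 := by exact_mod_cast h1
    unfold batchSize at h5
    linarith
  have h6 : ((i - s : ℕ) : ℝ) * stepSize η α i ≤
      ∑ k ∈ Finset.Ico s i, stepSize η α (k + 1) := by
    rw [← nsmul_eq_mul, ← Nat.card_Ico]
    refine Finset.card_nsmul_le_sum _ _ _ fun k hk => ?_
    exact stepSize_anti hη hα (by omega) (Finset.mem_Ico.1 hk).2
  refine le_trans ?_ h6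
  have h7 := stepSize_pos (α := α) hη hi
  have h8 := stepSize_le hη hα hi
  have h9 : (i : ℝ) ^ α * stepSize η α i = η := by
    rw [stepSize, mul_left_comm, ← Real.rpow_add hi0]; simp
  have h10 := mul_le_mul_of_nonneg_right h3 h7.le
  have h11 : C * (i : ℝ) ^ α * Real.log i * stepSize η α i = η * C * Real.log i := by
    calc _ = C * Real.log i * ((i : ℝ) ^ α * stepSize η α i) := by ring
      _ = _ := by rw [h9]; ring
  linarith

/-- Every error in the cut part is older than `s`, so its weight in `X_i` is its weight in `X_s`
times one common product `P` of size `O(i ^ (-η C))`. A row sum and a column sum bound the rest. -/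
theorem exists_cut_bound (C : ℝ) (hη : 0 < η) (hα : α ∈ Set.Ioo (0 : ℝ) 1) :
    ∃ B : ℝ, 0 < B ∧ ∀ i n : ℕ, 1 ≤ i →
      |∑ j ∈ Finset.range n, coef η α i j * cutCoef η α C i j| ≤ B * (i : ℝ) ^ (-(η * C)) := by
  obtain ⟨R₁, hR₁, hrow⟩ := exists_row_bound hη hα.1
  obtain ⟨R₂, hR₂, hcol⟩ := exists_column_bound hη hα
  obtain ⟨D, hD, hprod⟩ := exists_abs_prod_le hη hα.1
  refine ⟨D * Real.exp (2 * η) * (R₁ * R₂), by positivity, fun i n hi => ?_⟩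
  have hi0 : (0 : ℝ) < i := by exact_mod_cast hi
  rcases le_or_gt (min (batchStart α C i) i) 1 with hs | hs
  · rw [Finset.sum_eq_zero fun j _ => by
      rw [cutCoef, Finset.Ico_eq_empty_of_le hs, Finset.sum_empty, mul_zero], abs_zero]
    positivity
  have hsum := le_sum_stepSize (C := C) hη hα.1 hi hs
  set s := min (batchStart α C i) i with hsdef
  set P := ∏ k ∈ Finset.Ico s i, (1 - stepSize η α (k + 1)) with hP
  have hPle : |P| ≤ D * Real.exp (2 * η) * (i : ℝ) ^ (-(η * C)) := by
    refine (hprod s i).trans ?_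
    rw [mul_assoc, Real.rpow_def_of_pos hi0, ← Real.exp_add]
    gcongr
    linarith
  have hterm : ∀ j, |coef η α i j * cutCoef η α C i j| ≤ |P| * (|coef η α s j| * R₂) := fun j => by
    rcases lt_or_ge j s with hj | hj
    · rw [abs_mul, coef_eq_prod η α hj (min_le_right _ _), abs_mul, mul_assoc]
      gcongr
      exact (Finset.abs_sum_le_sum_abs _ _).trans (hcol j _)
    · have : cutCoef η α C i j = 0 := Finset.sum_eq_zero fun m hm =>
        coef_eq_zero η α (by have := (Finset.mem_Ico.1 hm).2; omega)
      rw [this, mul_zero, abs_zero]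
      positivity
  calc _ ≤ ∑ j ∈ Finset.range n, |coef η α i j * cutCoef η α C i j| :=
        Finset.abs_sum_le_sum_abs _ _
    _ ≤ ∑ j ∈ Finset.range n, |P| * (|coef η α s j| * R₂) := Finset.sum_le_sum fun j _ => hterm j
    _ = |P| * ((∑ j ∈ Finset.range n, |coef η α s j|) * R₂) := by
        rw [Finset.sum_mul, Finset.mul_sum]
    _ ≤ D * Real.exp (2 * η) * (i : ℝ) ^ (-(η * C)) * (R₁ * R₂) := by
        gcongr
        exact hrow s _
    _ = _ := by ring

theorem exists_bias_bound (hη : 0 < η) (hα : α ∈ Set.Ioo (0 : ℝ) 1) (hC : 1 < η * C) :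
    ∃ B : ℝ, 0 < B ∧ ∀ n : ℕ, |∑ i ∈ Finset.Icc 1 n, ∑ j ∈ Finset.range n,
      coef η α i j * cutCoef η α C i j| ≤ B := by
  obtain ⟨B, hB, hcut⟩ := exists_cut_bound C hη hα
  have hsum : Summable fun i : ℕ => (i : ℝ) ^ (-(η * C)) :=
    Real.summable_nat_rpow.2 (by linarith)
  have hnn : ∀ i : ℕ, 0 ≤ (i : ℝ) ^ (-(η * C)) := fun i => by positivity
  have htsum : 0 ≤ ∑' i : ℕ, (i : ℝ) ^ (-(η * C)) := tsum_nonneg hnn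
  refine ⟨B * (∑' i : ℕ, (i : ℝ) ^ (-(η * C)) + 1), by positivity, fun n => ?_⟩
  calc _ ≤ ∑ i ∈ Finset.Icc 1 n, |∑ j ∈ Finset.range n, coef η α i j * cutCoef η α C i j| :=
        Finset.abs_sum_le_sum_abs _ _
    _ ≤ ∑ i ∈ Finset.Icc 1 n, B * (i : ℝ) ^ (-(η * C)) :=
        Finset.sum_le_sum fun i hi => hcut i n (Finset.mem_Icc.1 hi).1
    _ = B * ∑ i ∈ Finset.Icc 1 n, (i : ℝ) ^ (-(η * C)) := by rw [Finset.mul_sum]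
    _ ≤ _ := by
        gcongr
        linarith [hsum.sum_le_tsum (Finset.Icc 1 n) fun i _ => hnn i]

theorem batchSize_le (hα : 0 < α) (hC : 0 < C) {i n : ℕ} (hi : 1 ≤ i) (hn : i ≤ n) :
    (batchSize α C i : ℝ) ≤ C * ((n : ℝ) ^ α * Real.log n) := by
  have hi1 : (1 : ℝ) ≤ i := by exact_mod_cast hi
  have hin : (i : ℝ) ≤ n := by exact_mod_cast hn
  have h0 := Real.log_nonneg hi1
  refine (Nat.floor_le (by positivity)).trans ?_
  rw [mul_assoc]
  have h1 : Real.log i ≤ Real.log n := Real.log_le_log (by linarith) hin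
  gcongr

/-- The sum of squares is at most the largest entry times the `ℓ¹` norm. Column sums bound the
entries; row sums and the batch length bound the norm. -/
theorem exists_quadCoef_bound (hη : 0 < η) (hα : α ∈ Set.Ioo (0 : ℝ) 1) (hC : 0 < C) :
    ∃ K : ℝ, 0 < K ∧ ∀ n : ℕ, 2 ≤ n → ∑ j ∈ Finset.range n, ∑ k ∈ Finset.range n,
      (quadCoef η α C n j k + quadCoef η α C n k j) ^ 2 ≤
        K * (n * ((n : ℝ) ^ α * Real.log n)) := by
  obtain ⟨R₁, hR₁, hrow⟩ := exists_row_bound hη hα.1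
  obtain ⟨R₂, hR₂, hcol⟩ := exists_column_bound hη hα
  refine ⟨4 * (R₂ * (3 * R₂) * (R₁ * (R₁ * (2 + 2 * C)))), by positivity, fun n hn => ?_⟩
  set T := (n : ℝ) ^ α * Real.log n with hT
  have hn2 : (2 : ℝ) ≤ n := by exact_mod_cast hn
  -- This absorbs the contribution of `X_i ^ 2`, which carries no batch length, into the main order.
  have hT1 : 1 ≤ 2 * T := by
    have h1 : (1 : ℝ) ≤ (n : ℝ) ^ α := Real.one_le_rpow (by linarith) hα.1.le
    have h2 : Real.log 2 ≤ Real.log n := Real.log_le_log (by norm_num) hn2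
    have h3 := Real.log_two_gt_d9
    nlinarith
  have hw : ∀ i k, |batchCoef η α C i k| ≤ R₂ := fun i k =>
    (Finset.abs_sum_le_sum_abs _ _).trans (hcol k _)
  have ha : ∀ i k, |coef η α i k| ≤ R₂ := fun i k => by simpa using hcol k {i}
  have haw : ∀ i k, |coef η α i k + 2 * batchCoef η α C i k| ≤
      |coef η α i k| + 2 * |batchCoef η α C i k| := fun i k => by
    refine (abs_add_le _ _).trans ?_
    rw [abs_mul, abs_two]
  have hwrow : ∀ i ∈ Finset.Icc 1 n, ∑ k ∈ Finset.range n, |batchCoef η α C i k| ≤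
      C * T * R₁ := fun i hi => by
    obtain ⟨hi1, hin⟩ := Finset.mem_Icc.1 hi
    calc _ ≤ ∑ k ∈ Finset.range n, ∑ m ∈ Finset.Ico (batchStart α C i) i, |coef η α m k| :=
          Finset.sum_le_sum fun k _ => Finset.abs_sum_le_sum_abs _ _
      _ = ∑ m ∈ Finset.Ico (batchStart α C i) i, ∑ k ∈ Finset.range n, |coef η α m k| :=
          Finset.sum_comm
      _ ≤ (Finset.Ico (batchStart α C i) i).card • R₁ :=
          Finset.sum_le_card_nsmul _ _ _ fun m _ => hrow m _
      _ ≤ (batchSize α C i : ℝ) * R₁ := by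
          rw [nsmul_eq_mul, Nat.card_Ico]
          gcongr
          unfold batchStart
          omega
      _ ≤ C * T * R₁ := by
          gcongr
          exact batchSize_le hα.1 hC hi1 hin
  have hq : ∀ j k, |quadCoef η α C n j k| ≤ R₂ * (3 * R₂) := fun j k => by
    calc _ ≤ ∑ i ∈ Finset.Icc 1 n, |coef η α i j * (coef η α i k + 2 * batchCoef η α C i k)| :=
          Finset.abs_sum_le_sum_abs _ _
      _ ≤ ∑ i ∈ Finset.Icc 1 n, |coef η α i j| * (3 * R₂) := by
          refine Finset.sum_le_sum fun i _ => ?_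
          rw [abs_mul]
          gcongr
          linarith [haw i k, ha i k, hw i k]
      _ ≤ _ := by
          rw [← Finset.sum_mul]
          gcongr
          exact hcol j _
  have hqsum : ∑ j ∈ Finset.range n, ∑ k ∈ Finset.range n, |quadCoef η α C n j k| ≤
      R₁ * (R₁ * (2 + 2 * C)) * (n * T) := by
    calc _ ≤ ∑ j ∈ Finset.range n, ∑ k ∈ Finset.range n, ∑ i ∈ Finset.Icc 1 n,
          |coef η α i j| * (|coef η α i k| + 2 * |batchCoef η α C i k|) := by
          refine Finset.sum_le_sum fun j _ => Finset.sum_le_sum fun k _ => ?_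
          refine (Finset.abs_sum_le_sum_abs _ _).trans (Finset.sum_le_sum fun i _ => ?_)
          rw [abs_mul]
          gcongr
          exact haw i k
      _ = ∑ i ∈ Finset.Icc 1 n, (∑ j ∈ Finset.range n, |coef η α i j|) *
          (∑ k ∈ Finset.range n, |coef η α i k| +
            2 * ∑ k ∈ Finset.range n, |batchCoef η α C i k|) := by
          rw [Finset.sum_congr rfl fun j _ => Finset.sum_comm, Finset.sum_comm]
          refine Finset.sum_congr rfl fun i _ => ?_
          rw [Finset.mul_sum, ← Finset.sum_add_distrib, Finset.sum_mul_sum]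
      _ ≤ ∑ i ∈ Finset.Icc 1 n, R₁ * (R₁ + 2 * (C * T * R₁)) := by
          refine Finset.sum_le_sum fun i hi => ?_
          gcongr
          · exact hrow i _
          · exact hrow i _
          · exact hwrow i hi
      _ = n * (R₁ * (R₁ + 2 * (C * T * R₁))) := by simp
      _ ≤ n * (R₁ * (R₁ * (2 * T) + 2 * (C * T * R₁))) := by
          gcongr
          exact le_mul_of_one_le_right (by linarith) hT1
      _ = _ := by ring
  calc _ ≤ ∑ j ∈ Finset.range n, ∑ k ∈ Finset.range n,
        (2 * (R₂ * (3 * R₂)) * |quadCoef η α C n j k| +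
          2 * (R₂ * (3 * R₂)) * |quadCoef η α C n k j|) := by
        refine Finset.sum_le_sum fun j _ => Finset.sum_le_sum fun k _ => ?_
        have h1 := mul_le_mul_of_nonneg_right (hq j k) (abs_nonneg (quadCoef η α C n j k))
        have h2 := mul_le_mul_of_nonneg_right (hq k j) (abs_nonneg (quadCoef η α C n k j))
        rw [abs_mul_abs_self] at h1 h2
        nlinarith [sq_nonneg (quadCoef η α C n j k - quadCoef η α C n k j)]
    _ = 4 * (R₂ * (3 * R₂)) *
        ∑ j ∈ Finset.range n, ∑ k ∈ Finset.range n, |quadCoef η α C n j k| := by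
        simp only [Finset.sum_add_distrib, ← Finset.mul_sum]
        rw [Finset.sum_comm (f := fun j k => |quadCoef η α C n k j|)]
        ring
    _ ≤ 4 * (R₂ * (3 * R₂)) * (R₁ * (R₁ * (2 + 2 * C)) * (n * T)) := by gcongr
    _ = _ := by ring

end Upper

theorem rate_eq (α : ℝ) {n : ℕ} (hn : 1 ≤ n) : (n : ℝ) ^ (α - 1) * Real.log n =
    ((n : ℝ)⁻¹) ^ 2 * (n * ((n : ℝ) ^ α * Real.log n)) := by
  have h : (n : ℝ) ≠ 0 := by positivity
  rw [Real.rpow_sub_one h]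
  field_simp

/-! ### Lower bound on the variance. -/

section Lower

open Filter Topology

variable {η α C : ℝ}

theorem coef_nonneg_of_half_le {n : ℕ} (hη : 0 < η)
    (hh : ∀ i, n ≤ 2 * i → i ≤ n → stepSize η α i ≤ 1) {j i : ℕ} (hj : n ≤ 2 * (j + 1))
    (hi : i ≤ n) : 0 ≤ coef η α i j := by
  rcases le_or_gt i j with hij | hij
  · rw [coef_eq_zero η α hij]
  · rw [coef_eq_prod η α (Nat.lt_succ_self j) hij, coef_succ_self]
    refine mul_nonneg (Finset.prod_nonneg fun k hk => ?_) (stepSize_pos hη (by omega)).le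
    obtain ⟨h1, h2⟩ := Finset.mem_Ico.1 hk
    linarith [hh (k + 1) (by omega) (by omega)]

/-- Over `m` steps after its creation the weight of an error loses at most half of its size, if
`m` times the step size is small. -/
theorem half_le_coef {n m : ℕ} {y : ℝ} (hy : 0 < y) (hy1 : 2 * y ≤ 1) (hmy : m * (2 * y) ≤ 1 / 2)
    (hlow : ∀ i, 1 ≤ i → i ≤ n → y ≤ stepSize η α i)
    (hup : ∀ i, n ≤ 2 * i → i ≤ n → stepSize η α i ≤ 2 * y) {j i : ℕ} (hj : n ≤ 2 * (j + 1))
    (hji : j < i) (him : i ≤ j + 1 + m) (hi : i ≤ n) : y / 2 ≤ coef η α i j := by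
  rw [coef_eq_prod η α (Nat.lt_succ_self j) hji, coef_succ_self]
  have h1 : (1 - 2 * y) ^ (i - (j + 1)) ≤
      ∏ k ∈ Finset.Ico (j + 1) i, (1 - stepSize η α (k + 1)) := by
    rw [← Nat.card_Ico, ← Finset.prod_const]
    refine Finset.prod_le_prod (fun _ _ => by linarith) fun k hk => ?_
    obtain ⟨h2, h3⟩ := Finset.mem_Ico.1 hk
    linarith [hup (k + 1) (by omega) (by omega)]
  have h2 : 1 / 2 ≤ (1 - 2 * y) ^ (i - (j + 1)) := by
    have h3 := one_add_mul_le_pow (a := -(2 * y)) (by linarith) (i - (j + 1))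
    have h4 : ((i - (j + 1) : ℕ) : ℝ) ≤ m := by exact_mod_cast (by omega)
    have h5 := mul_le_mul_of_nonneg_right h4 (by linarith : 0 ≤ 2 * y)
    rw [← sub_eq_add_neg] at h3
    linarith
  calc y / 2 = 1 / 2 * y := by ring
    _ ≤ _ := mul_le_mul (h2.trans h1) (hlow (j + 1) (by omega) (by omega)) hy.le
        (by linarith [h2.trans h1])

/-- For each of the `m` indices `i` just after `j`, the weight of error `j` is at least `y / 2`, and
the batch of `i` contains the `m` iterates just after `k`, each with weight at least `y / 2` on
error `k`. Past `n / 2` all weights are nonnegative, so the other terms can be dropped. -/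
theorem le_quadCoef {n m : ℕ} {y : ℝ} (hη : 0 < η) (hy : 0 < y) (hy1 : 2 * y ≤ 1)
    (hmy : m * (2 * y) ≤ 1 / 2)
    (hlow : ∀ i, 1 ≤ i → i ≤ n → y ≤ stepSize η α i)
    (hup : ∀ i, n ≤ 2 * i → i ≤ n → stepSize η α i ≤ 2 * y) {j k : ℕ} (hk : n ≤ 2 * (k + 1))
    (hkj : k + m + 1 ≤ j) (hjn : j + 1 + m ≤ n)
    (hbatch : ∀ i, n ≤ 2 * i → i ≤ n → j + m ≤ k + batchSize α C i) :
    (m * (y / 2)) ^ 2 ≤ quadCoef η α C n j k := by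
  have hnn : ∀ {j i : ℕ}, n ≤ 2 * (j + 1) → i ≤ n → 0 ≤ coef η α i j := fun hj hi =>
    coef_nonneg_of_half_le hη (fun i h1 h2 => (hup i h1 h2).trans hy1) hj hi
  have hj : n ≤ 2 * (j + 1) := by omega
  have hwnn : ∀ i ≤ n, 0 ≤ batchCoef η α C i k := fun i hi =>
    Finset.sum_nonneg fun p hp => hnn hk (by have := (Finset.mem_Ico.1 hp).2; omega)
  have hw : ∀ i ∈ Finset.Ico (j + 1) (j + 1 + m), m * (y / 2) ≤ batchCoef η α C i k := by
    intro i hi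
    obtain ⟨h1, h2⟩ := Finset.mem_Ico.1 hi
    have h3 := hbatch i (by omega) (by omega)
    calc m * (y / 2) = (Finset.Ico (k + 1) (k + 1 + m)).card • (y / 2) := by
          rw [nsmul_eq_mul, Nat.card_Ico, Nat.add_sub_cancel_left]
      _ ≤ ∑ p ∈ Finset.Ico (k + 1) (k + 1 + m), coef η α p k := by
          refine Finset.card_nsmul_le_sum _ _ _ fun p hp => ?_
          obtain ⟨h4, h5⟩ := Finset.mem_Ico.1 hp
          exact half_le_coef hy hy1 hmy hlow hup hk (by omega) (by omega) (by omega)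
      _ ≤ batchCoef η α C i k := by
          refine Finset.sum_le_sum_of_subset_of_nonneg (fun p hp => ?_) fun p hp _ =>
            hnn hk (by have := (Finset.mem_Ico.1 hp).2; omega)
          obtain ⟨h4, h5⟩ := Finset.mem_Ico.1 hp
          refine Finset.mem_Ico.2 ⟨?_, by omega⟩
          unfold batchStart
          omega
  calc (m * (y / 2)) ^ 2 = (Finset.Ico (j + 1) (j + 1 + m)).card • (y / 2 * (m * (y / 2))) := by
        rw [nsmul_eq_mul, Nat.card_Ico, Nat.add_sub_cancel_left]; ring
    _ ≤ ∑ i ∈ Finset.Ico (j + 1) (j + 1 + m),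
        coef η α i j * (coef η α i k + 2 * batchCoef η α C i k) := by
        refine Finset.card_nsmul_le_sum _ _ _ fun i hi => ?_
        obtain ⟨h4, h5⟩ := Finset.mem_Ico.1 hi
        have h6 := hw i hi
        have h7 := hwnn i (by omega)
        have h8 := hnn hk (by omega : i ≤ n)
        have h9 : y / 2 ≤ coef η α i j :=
          half_le_coef hy hy1 hmy hlow hup hj (by omega) (by omega) (by omega)
        exact mul_le_mul h9 (by linarith) (by positivity) (by linarith)
    _ ≤ quadCoef η α C n j k := by
        refine Finset.sum_le_sum_of_subset_of_nonneg (fun i hi => ?_) fun i hi _ => ?_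
        · obtain ⟨h4, h5⟩ := Finset.mem_Ico.1 hi
          exact Finset.mem_Icc.2 ⟨by omega, by omega⟩
        · have hin := (Finset.mem_Icc.1 hi).2
          exact mul_nonneg (hnn hj hin) (by linarith [hnn hk hin, hwnn i hin])

theorem quadCoef_nonneg {n : ℕ} (hη : 0 < η)
    (hh : ∀ i, n ≤ 2 * i → i ≤ n → stepSize η α i ≤ 1) {j k : ℕ} (hj : n ≤ 2 * (j + 1))
    (hk : n ≤ 2 * (k + 1)) : 0 ≤ quadCoef η α C n j k := by
  refine Finset.sum_nonneg fun i hi => ?_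
  have hin := (Finset.mem_Icc.1 hi).2
  have h1 : 0 ≤ batchCoef η α C i k := Finset.sum_nonneg fun p hp =>
    coef_nonneg_of_half_le hη hh hk (by have := (Finset.mem_Ico.1 hp).2; omega)
  have h2 := coef_nonneg_of_half_le hη hh hk hin
  exact mul_nonneg (coef_nonneg_of_half_le hη hh hj hin) (by linarith)

theorem le_sum_quadCoef_sq {n m L : ℕ} {y : ℝ} (hη : 0 < η) (hy : 0 < y) (hy1 : 2 * y ≤ 1)
    (hmy : m * (2 * y) ≤ 1 / 2)
    (hlow : ∀ i, 1 ≤ i → i ≤ n → y ≤ stepSize η α i)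
    (hup : ∀ i, n ≤ 2 * i → i ≤ n → stepSize η α i ≤ 2 * y) (hmL : 4 * (2 * m + L) ≤ n)
    (hbatch : ∀ i, n ≤ 2 * i → i ≤ n → 2 * m + L ≤ batchSize α C i) :
    ((n / 8 : ℕ) : ℝ) * (L * ((m * (y / 2)) ^ 2) ^ 2) ≤ ∑ k ∈ Finset.range n,
      ∑ j ∈ Finset.range n, (quadCoef η α C n k j + quadCoef η α C n j k) ^ 2 := by
  have hnn : ∀ k, 0 ≤ ∑ j ∈ Finset.range n,
      (quadCoef η α C n k j + quadCoef η α C n j k) ^ 2 := fun k =>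
    Finset.sum_nonneg fun _ _ => sq_nonneg _
  calc _ = (Finset.Ico (n / 2) (n / 2 + n / 8)).card • ((L : ℝ) * ((m * (y / 2)) ^ 2) ^ 2) := by
        rw [nsmul_eq_mul, Nat.card_Ico, Nat.add_sub_cancel_left]
    _ ≤ ∑ k ∈ Finset.Ico (n / 2) (n / 2 + n / 8), ∑ j ∈ Finset.range n,
        (quadCoef η α C n k j + quadCoef η α C n j k) ^ 2 := by
        refine Finset.card_nsmul_le_sum _ _ _ fun k hk => ?_
        obtain ⟨hk1, hk2⟩ := Finset.mem_Ico.1 hk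
        -- The gap `m` separates the two windows; `2 * m + L` is the farthest that a batch must
        -- reach back.
        calc _ = (Finset.Ico (k + m + 1) (k + m + 1 + L)).card • ((m * (y / 2)) ^ 2) ^ 2 := by
              rw [nsmul_eq_mul, Nat.card_Ico, Nat.add_sub_cancel_left]
          _ ≤ ∑ j ∈ Finset.Ico (k + m + 1) (k + m + 1 + L),
              (quadCoef η α C n k j + quadCoef η α C n j k) ^ 2 := by
              refine Finset.card_nsmul_le_sum _ _ _ fun j hj => ?_
              obtain ⟨hj1, hj2⟩ := Finset.mem_Ico.1 hj
              have h1 : (m * (y / 2)) ^ 2 ≤ quadCoef η α C n j k :=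
                le_quadCoef hη hy hy1 hmy hlow hup (by omega) hj1 (by omega) fun i h2 h3 => by
                  have := hbatch i h2 h3
                  omega
              have h2 : 0 ≤ quadCoef η α C n k j := quadCoef_nonneg hη
                (fun i h1 h2 => (hup i h1 h2).trans hy1) (by omega) (by omega)
              gcongr
              linarith
          _ ≤ _ := by
              refine Finset.sum_le_sum_of_subset_of_nonneg (fun j hj => ?_) fun _ _ _ =>
                sq_nonneg _
              have := (Finset.mem_Ico.1 hj).2
              exact Finset.mem_range.2 (by omega)
    _ ≤ _ := by
        refine Finset.sum_le_sum_of_subset_of_nonneg (fun k hk => ?_) fun k _ _ => hnn k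
        have := (Finset.mem_Ico.1 hk).2
        exact Finset.mem_range.2 (by omega)

theorem half_rpow_le (hα : α ∈ Set.Ioo (0 : ℝ) 1) {n i : ℕ} (hi : n ≤ 2 * i) :
    (n : ℝ) ^ α / 2 ≤ (i : ℝ) ^ α := by
  have h1 : (n : ℝ) ≤ 2 * i := by exact_mod_cast hi
  have h2 : (n : ℝ) ^ α ≤ 2 * (i : ℝ) ^ α := by
    calc (n : ℝ) ^ α ≤ (2 * i) ^ α := Real.rpow_le_rpow (by positivity) h1 hα.1.le
      _ = 2 ^ α * (i : ℝ) ^ α := Real.mul_rpow (by norm_num) (by positivity)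
      _ ≤ 2 * (i : ℝ) ^ α := by
        gcongr
        calc (2 : ℝ) ^ α ≤ 2 ^ (1 : ℝ) :=
              Real.rpow_le_rpow_of_exponent_le (by norm_num) hα.2.le
          _ = 2 := Real.rpow_one 2
  linarith

theorem le_batchSize_add_one (hα : α ∈ Set.Ioo (0 : ℝ) 1) (hC : 0 < C) {n i : ℕ} (hn : 4 ≤ n)
    (hi : n ≤ 2 * i) : C / 4 * ((n : ℝ) ^ α * Real.log n) < batchSize α C i + 1 := by
  have h1 : (n : ℝ) ≤ 2 * i := by exact_mod_cast hi
  have hn4 : (4 : ℝ) ≤ n := by exact_mod_cast hn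
  have hi2 : (2 : ℝ) ≤ i := by linarith
  have h2 : Real.log n / 2 ≤ Real.log i := by
    have h3 : Real.log n ≤ Real.log ((i : ℝ) ^ 2) :=
      Real.log_le_log (by linarith) (by nlinarith)
    rw [Real.log_pow] at h3
    push_cast at h3
    linarith
  have h0 : 0 ≤ Real.log n := Real.log_nonneg (by linarith)
  refine lt_of_le_of_lt ?_ (Nat.lt_floor_add_one (C * (i : ℝ) ^ α * Real.log i))
  calc C / 4 * ((n : ℝ) ^ α * Real.log n) = C * ((n : ℝ) ^ α / 2) * (Real.log n / 2) := by ring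
    _ ≤ C * (i : ℝ) ^ α * Real.log i := by
      gcongr
      exact half_rpow_le hα hi

theorem eventually_le_sum_quadCoef_sq (hη : 0 < η) (hα : α ∈ Set.Ioo (0 : ℝ) 1) (hC : 0 < C) :
    ∃ c : ℝ, 0 < c ∧ ∀ᶠ n : ℕ in atTop, c * (n * ((n : ℝ) ^ α * Real.log n)) ≤
      ∑ k ∈ Finset.range n, ∑ j ∈ Finset.range n,
        (quadCoef η α C n k j + quadCoef η α C n j k) ^ 2 := by
  -- The factors are lower bounds for `n / 8` (by `n / 16`), for `L` (by `C / 16 * n ^ α log n`) and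
  -- for `m * (y / 2)` (by `1 / 32`), with `y = η n ^ (-α)`.
  refine ⟨1 / 16 * (C / 16 * ((1 / 32) ^ 2) ^ 2), by positivity, ?_⟩
  have hnat : Tendsto (fun n : ℕ => (n : ℝ)) atTop atTop := tendsto_natCast_atTop_atTop
  have t1 := (tendsto_rpow_atTop hα.1).comp hnat
  have t2 := Real.tendsto_log_atTop.comp hnat
  -- Here `α < 1` makes `C n ^ α log n ≤ n`, so the windows fit below `n`.
  have o1 := ((isLittleO_log_rpow_atTop (by linarith [hα.2] : 0 < 1 - α)).comp_tendsto hnat).bound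
    (by positivity : 0 < 1 / C)
  filter_upwards [t1.eventually_ge_atTop (16 * η), t1.eventually_ge_atTop 1,
    t2.eventually_ge_atTop ((1 / (4 * η) + 1) * (8 / C)), t2.eventually_ge_atTop (16 / C),
    t2.eventually_ge_atTop 0, o1, eventually_ge_atTop 16] with n hx hx1 hl1 hl2 hl0 ho hn
  simp only [Function.comp_apply] at hx hx1 hl1 hl2 hl0 ho
  have hn0 : (0 : ℝ) < n := by positivity
  set x := (n : ℝ) ^ α with hxdef
  set l := Real.log n with hldef
  have hx0 : 0 < x := by linarith
  have hxy : (n : ℝ) ^ (-α) = x⁻¹ := Real.rpow_neg hn0.le α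
  -- `m` is a fixed fraction of the decay time, so weights lose at most half; `L` is half of the
  -- guaranteed batch length `C / 4 * (x * l)`, leaving room for `2 * m + 1`.
  set m := ⌊x / (8 * η)⌋₊ with hm
  set L := ⌊C / 8 * (x * l)⌋₊ with hL
  have hm1 : (m : ℝ) ≤ x / (8 * η) := Nat.floor_le (by positivity)
  have hm2 : x / (16 * η) ≤ m := by
    have h1 := Nat.lt_floor_add_one (x / (8 * η))
    have h2 : 1 ≤ x / (16 * η) := by rw [one_le_div (by positivity)]; exact hx
    have h3 : x / (8 * η) = 2 * (x / (16 * η)) := by field_simp; norm_num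
    rw [← hm] at h1
    linarith
  have hL1 : (L : ℝ) ≤ C / 8 * (x * l) := Nat.floor_le (by positivity)
  have hxl : l ≤ x * l := le_mul_of_one_le_left hl0 hx1
  have hL2 : C / 16 * (x * l) ≤ L := by
    have h1 := Nat.lt_floor_add_one (C / 8 * (x * l))
    have h2 : 16 ≤ C * l := by
      have := mul_le_mul_of_nonneg_left hl2 hC.le
      rwa [mul_div_cancel₀ _ hC.ne'] at this
    have h3 := mul_le_mul_of_nonneg_left hxl hC.le
    rw [← hL] at h1
    linarith
  have hmL : 2 * (m : ℝ) + L + 1 ≤ C / 4 * (x * l) := by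
    have h1 : 1 / (4 * η) + 1 ≤ C / 8 * l := by
      have := mul_le_mul_of_nonneg_left hl1 (by positivity : 0 ≤ C / 8)
      have e : C / 8 * ((1 / (4 * η) + 1) * (8 / C)) = 1 / (4 * η) + 1 := by field_simp
      linarith
    have h2 := mul_le_mul_of_nonneg_left h1 hx0.le
    have h3 : x / (8 * η) = x * (1 / (4 * η)) / 2 := by field_simp; norm_num
    linarith
  have hCn : C * (x * l) ≤ n := by
    rw [Real.norm_of_nonneg hl0, Real.norm_of_nonneg (by positivity)] at ho
    calc C * (x * l) ≤ C * (x * (1 / C * (n : ℝ) ^ (1 - α))) := by gcongr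
      _ = x * (n : ℝ) ^ (1 - α) := by field_simp
      _ = n := by rw [hxdef, ← Real.rpow_add hn0]; simp
  have hy : 0 < η * x⁻¹ := by positivity
  have hmain := le_sum_quadCoef_sq (η := η) (α := α) (C := C) (n := n) (m := m) (L := L)
    (y := η * x⁻¹) hη hy ?_ ?_ ?_ ?_ ?_ ?_
  · refine le_trans ?_ hmain
    have h1 : 1 / 32 ≤ m * (η * x⁻¹ / 2) := by
      calc (1 : ℝ) / 32 = x / (16 * η) * (η * x⁻¹ / 2) := by field_simp; norm_num
        _ ≤ _ := by gcongr
    have h2 : (n : ℝ) / 16 ≤ ((n / 8 : ℕ) : ℝ) := by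
      have h3 : n ≤ 16 * (n / 8) := by omega
      have h4 : (n : ℝ) ≤ 16 * ((n / 8 : ℕ) : ℝ) := by exact_mod_cast h3
      linarith
    calc _ = (n : ℝ) / 16 * (C / 16 * (x * l) * ((1 / 32) ^ 2) ^ 2) := by ring
      _ ≤ _ := by gcongr
  · rw [← div_eq_mul_inv, mul_div_assoc', div_le_one hx0]
    linarith
  · calc (m : ℝ) * (2 * (η * x⁻¹)) ≤ x / (8 * η) * (2 * (η * x⁻¹)) := by gcongr
      _ ≤ 1 / 2 := by field_simp; norm_num
  · intro i hi1 hin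
    have h1 : stepSize η α n = η * x⁻¹ := by rw [stepSize, hxy]
    rw [← h1]
    exact stepSize_anti hη hα.1 hi1 hin
  · intro i hi hin
    have h1 := half_rpow_le hα hi
    have hi0 : (0 : ℝ) < i := by exact_mod_cast (by omega : 0 < i)
    rw [stepSize, Real.rpow_neg hi0.le, mul_left_comm]
    gcongr
    calc ((i : ℝ) ^ α)⁻¹ ≤ (x / 2)⁻¹ := inv_anti₀ (by positivity) h1
      _ = 2 * x⁻¹ := by rw [inv_div]; rfl
  · have h1 : 4 * (2 * (m : ℝ) + L) ≤ n := by linarith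
    exact_mod_cast h1
  · intro i hi hin
    have h1 := le_batchSize_add_one hα hC (by omega : 4 ≤ n) hi
    have h2 : 2 * (m : ℝ) + L < batchSize α C i + 1 := by linarith
    have h3 : 2 * m + L < batchSize α C i + 1 := by exact_mod_cast h2
    omega

/-- The newest error enters only `X_{n+1}` and no batch sum. This one entry makes the variance
positive for every sample size, not only large ones. -/
theorem quadCoef_last (η α C : ℝ) (n : ℕ) :
    quadCoef η α C (n + 1) n n = stepSize η α (n + 1) ^ 2 := by
  have hw : ∀ i ≤ n + 1, batchCoef η α C i n = 0 := fun i hi =>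
    Finset.sum_eq_zero fun m hm =>
      coef_eq_zero η α (by have := (Finset.mem_Ico.1 hm).2; omega)
  rw [quadCoef, Finset.sum_Icc_succ_top (by omega), hw _ le_rfl, coef_succ_self,
    Finset.sum_eq_zero fun i hi => by
      rw [coef_eq_zero η α (Finset.mem_Icc.1 hi).2, zero_mul]]
  ring

theorem sum_quadCoef_sq_pos (α C : ℝ) (hη : 0 < η) {n : ℕ} (hn : 1 ≤ n) :
    0 < ∑ k ∈ Finset.range n, ∑ j ∈ Finset.range n,
      (quadCoef η α C n k j + quadCoef η α C n j k) ^ 2 := by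
  obtain ⟨n, rfl⟩ : ∃ p, n = p + 1 := ⟨n - 1, by omega⟩
  have hmem : n ∈ Finset.range (n + 1) := Finset.mem_range.2 (Nat.lt_succ_self n)
  refine Finset.sum_pos' (fun k _ => Finset.sum_nonneg fun _ _ => sq_nonneg _) ⟨n, hmem, ?_⟩
  refine Finset.sum_pos' (fun _ _ => sq_nonneg _) ⟨n, hmem, ?_⟩
  have := stepSize_pos (α := α) hη (Nat.le_add_left 1 n)
  rw [quadCoef_last]
  positivity

theorem exists_pos_mul_le {f g : ℕ → ℝ} {N : ℕ} (hf : ∀ n, N ≤ n → 0 < f n)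
    (hg : ∀ n, N ≤ n → 0 < g n) (h : ∃ c : ℝ, 0 < c ∧ ∀ᶠ n in atTop, c * g n ≤ f n) :
    ∃ c : ℝ, 0 < c ∧ ∀ n, N ≤ n → c * g n ≤ f n := by
  obtain ⟨c, hc, h⟩ := h
  obtain ⟨M, hM⟩ := eventually_atTop.1 h
  have key : ∀ M, ∃ d : ℝ, 0 < d ∧ ∀ n, N ≤ n → n < M → d * g n ≤ f n := by
    intro M
    induction M with
    | zero => exact ⟨1, one_pos, fun n _ hn => by omega⟩
    | succ M ih =>
      obtain ⟨d, hd, ih⟩ := ih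
      rcases lt_or_ge M N with hMN | hMN
      · exact ⟨d, hd, fun n h1 h2 => by omega⟩
      · refine ⟨min d (f M / g M), lt_min hd (div_pos (hf M hMN) (hg M hMN)), fun n h1 h2 => ?_⟩
        rcases Nat.lt_succ_iff_lt_or_eq.1 h2 with h3 | rfl
        · exact (mul_le_mul_of_nonneg_right (min_le_left _ _) (hg n h1).le).trans (ih n h1 h3)
        · exact (le_div_iff₀ (hg n h1)).1 (min_le_right _ _)
  obtain ⟨d, hd, hd'⟩ := key M
  refine ⟨min c d, lt_min hc hd, fun n hn => ?_⟩
  rcases lt_or_ge n M with h1 | h1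
  · exact (mul_le_mul_of_nonneg_right (min_le_right _ _) (hg n hn).le).trans (hd' n hn h1)
  · exact (mul_le_mul_of_nonneg_right (min_le_left _ _) (hg n hn).le).trans (hM n h1)

end Lower

end GaussianMeanEstimation

/-! ### Assembly of the two-sided bound. -/

open GaussianMeanEstimation in
theorem mainTheorem3 (α η C : ℝ) (σe : ℝ≥0) (hα : α ∈ Set.Ioo (1 / 2 : ℝ) 1) (hη : 0 < η)
    (hC : 1 < η * C) (hσ : 0 < σe) :
    ∃ c₁ c₂ : ℝ, 0 < c₁ ∧ 0 < c₂ ∧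
      ∀ (Ω : Type*) [MeasurableSpace Ω] (μ : Measure Ω) [IsProbabilityMeasure μ]
        (e : ℕ → Ω → ℝ),
        iIndepFun (fun i : ℕ => e (i + 1)) μ →
        (∀ i : ℕ, 1 ≤ i → HasLaw (e i) (gaussianReal 0 (σe ^ 2)) μ) →
        ∀ n : ℕ, 2 ≤ n →
          c₁ * ((n : ℝ) ^ (α - 1) * Real.log n) ≤ GaussianMeanEstimation.mse μ η α C e n ∧
          GaussianMeanEstimation.mse μ η α C e n ≤ c₂ * ((n : ℝ) ^ (α - 1) * Real.log n) := by
  have hα' : α ∈ Set.Ioo (0 : ℝ) 1 := ⟨by linarith [hα.1], hα.2⟩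
  have hC0 : 0 < C := pos_of_mul_pos_right (one_pos.trans hC) hη.le
  have hlog : ∀ n : ℕ, 2 ≤ n → 0 < Real.log n := fun n hn =>
    Real.log_pos (by exact_mod_cast (by omega : 1 < n))
  have hrate : ∀ n : ℕ, 2 ≤ n → 0 < (n : ℝ) * ((n : ℝ) ^ α * Real.log n) := fun n hn => by
    have h1 := hlog n hn
    have h2 : (0 : ℝ) < n := by exact_mod_cast (by omega : 0 < n)
    positivity
  obtain ⟨B, hB, hbias⟩ := exists_bias_bound hη hα' hC
  obtain ⟨K, hK, hup⟩ := exists_quadCoef_bound hη hα' hC0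
  obtain ⟨c, hc, hlow⟩ := exists_pos_mul_le (N := 2)
    (fun n hn => sum_quadCoef_sq_pos α C hη (by omega)) hrate
    (eventually_le_sum_quadCoef_sq hη hα' hC0)
  obtain ⟨v, hv, hv0⟩ : ∃ v : ℝ, ((σe ^ 2 : ℝ≥0) : ℝ) = v ∧ 0 < v :=
    ⟨_, rfl, by exact_mod_cast pow_pos hσ 2⟩
  -- The constants come from deterministic coefficient bounds, so they precede the probability
  -- space. The bias is dropped below and, above, absorbed through `1 ≤ n * (n ^ α * log n)`.
  refine ⟨v ^ 2 / 2 * c, 4 * v ^ 2 * B ^ 2 + v ^ 2 / 2 * K, by positivity, by positivity, ?_⟩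
  intro Ω _ μ _ e hi hl n hn
  have hnoise : IsGaussianNoise μ v fun i => e (i + 1) := by
    rw [← hv]
    exact .of_hasLaw hi fun i => hl (i + 1) (by omega)
  rw [mse_eq hnoise η α C (by omega : n ≠ 0), rate_eq α (by omega), mul_left_comm,
    mul_left_comm (4 * v ^ 2 * B ^ 2 + v ^ 2 / 2 * K)]
  have h1 : 1 ≤ (n : ℝ) * ((n : ℝ) ^ α * Real.log n) := by
    have hn2 : (2 : ℝ) ≤ n := by exact_mod_cast hn
    have h2 : (1 : ℝ) ≤ (n : ℝ) ^ α := Real.one_le_rpow (by linarith) hα'.1.le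
    have h3 : Real.log 2 ≤ Real.log n := Real.log_le_log (by norm_num) hn2
    have h4 := Real.log_two_gt_d9
    have h5 : 1 / 2 ≤ (n : ℝ) ^ α * Real.log n := by nlinarith
    nlinarith
  have h2 : (∑ i ∈ Finset.Icc 1 n, ∑ j ∈ Finset.range n,
      coef η α i j * cutCoef η α C i j) ^ 2 ≤ B ^ 2 := sq_le_sq' (abs_le.1 (hbias n)).1
        (abs_le.1 (hbias n)).2
  constructor
  · gcongr
    have h3 := mul_le_mul_of_nonneg_left (hlow n hn) (by positivity : 0 ≤ v ^ 2 / 2)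
    have h4 : 0 ≤ 4 * v ^ 2 * (∑ i ∈ Finset.Icc 1 n, ∑ j ∈ Finset.range n,
      coef η α i j * cutCoef η α C i j) ^ 2 := by positivity
    linarith
  · gcongr
    have h3 := mul_le_mul_of_nonneg_left (hup n hn) (by positivity : 0 ≤ v ^ 2 / 2)
    have h4 := mul_le_mul_of_nonneg_left h2 (by positivity : 0 ≤ 4 * v ^ 2)
    have h5 : 4 * v ^ 2 * B ^ 2 ≤ 4 * v ^ 2 * B ^ 2 * (n * ((n : ℝ) ^ α * Real.log n)) :=
      le_mul_of_one_le_right (by positivity) h1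
    linarith
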